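/- Let $\mathbb X$ be a measurable space with measurable diagonal, $\mu$ a $\sigma$-finite measure on $\mathbb X$, and $H$ a probability measure without atoms on $\mathbb X$ with density $h$ with respect to $\mu$. Let $\alpha,\tau>0$ and put $\lambda(w)=\alpha w^{-1}e^{-\tau w}$, $w>0$. Let $G\sim\Gamma(\alpha,\tau,H)$ be a gamma process on $\mathbb X$: a random measure such that $G(A)\sim\mathrm{Gamma}(\alpha H(A),\tau)$ (shape, inverse scale; the point mass at $0$ if $H(A)=0$) for every measurable $A$, and such that $G(A_1),\dots,G(A_n)$ are independent whenever $A_1,\dots,A_n$ are pairwise disjoint measurable sets. Given $G$, let $(Y_\ell,Z_\ell)$, $\ell=1,\dots,L$, be independent and identically distributed, where $Y_\ell=(Y_{\ell1},\dots,Y_{\ell m})$ is a Plackett--Luce top-$m$ list with $$P(Y_\ell\mid G)=\prod_{i=1}^m\frac{G(\{Y_{\ell i}\})}{G(\mathbb X\setminus\{Y_{\ell1},\dots,Y_{\ell,i-1}\})}$$ (that is, each item is drawn from $G$ with the items already picked removed, and normalised), and, given $G$ and $Y_\ell$, the latent variables $Z_{\ell1},\dots,Z_{\ell m}$ are independent with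 $Z_{\ell i}\sim\mathrm{Exp}\big(G(\mathbb X\setminus\{Y_{\ell1},\dots,Y_{\ell,i-1}\})\big)$. Denote by $X_1^*,\dots,X_K^*$ the distinct items among the $L$ lists, by $n_k$ the number of occurrences of $X^*_k$ in them, and let $\delta_{\ell ik}=0$ if $Y_{\ell j}=X^*_k$ for some $j<i$, and $\delta_{\ell ik}=1$ otherwise. Then the joint law of $(Y_\ell,Z_\ell)_{\ell=1}^L$ has the density $$e^{-\psi\left(\sum_{\ell,i}Z_{\ell i}\right)}\prod_{k=1}^K h(X_k^*)\,\kappa\Big(n_k,\sum_{\ell,i}\delta_{\ell ik}Z_{\ell i}\Big)$$ (on data with no repeated item within a list and with all $Z_{\ell i}\ge0$; the density is $0$ elsewhere). The reference measure is Lebesgue measure in the $Z_{\ell i}$ and, in the lists, the sum over all tie patterns (partitions of the $Lm$ places into blocks, the places of a block carrying the same item) of the measures obtained by integrating the item of each block with respect to $\mu$, independently over the blocks. Here, for $z\ge0$ and integers $n\ge1$, $$\psi(z)=-\log\mathbb E\big[e^{-zG(\mathbb X)}\big]=\int_0^\infty(1-e^{-zw})\lambda(w)\,dw=\alpha\log\Big(1+\frac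 z\tau\Big),$$ $$\kappa(n,z)=\int_0^\infty w^ne^{-zw}\lambda(w)\,dw=\frac{\alpha\,\Gamma(n)}{(z+\tau)^n},$$ and both integrals converge. -/

import Mathlib

open MeasureTheory ProbabilityTheory Set

noncomputable section

/-- The gamma distribution with shape `a` and inverse scale `r`, as a law on `[0, ∞]`;
for shape `0` it is the point mass at `0`. -/
def gammaLaw (a r : ℝ) : Measure ENNReal :=
  if a = 0 then Measure.dirac 0 else (gammaMeasure a r).map ENNReal.ofReal

/-- `G` is a gamma process with concentration `α`, inverse scale `τ` and base distribution `H`: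
a completely random measure (a random measure whose masses on pairwise disjoint measurable sets
are mutually independent) with gamma marginals `G(A) ~ Gamma(α H(A), τ)`. -/
structure IsGammaProcess {Ω X : Type*} [MeasurableSpace Ω] [MeasurableSpace X]
    (α τ : ℝ) (H : Measure X) (G : Ω → Measure X) (P : Measure Ω) : Prop where
  measurable : Measurable G
  marginal : ∀ A : Set X, MeasurableSet A →
    P.map (fun ω => G ω A) = gammaLaw (α * (H A).toReal) τ
  indep : ∀ (n : ℕ) (A : Fin n → Set X), (∀ k, MeasurableSet (A k)) →
    Pairwise (fun j k => Disjoint (A j) (A k)) → iIndepFun (fun k ω => G ω (A k)) P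

/-- The Lévy intensity `λ(w) = α w⁻¹ e^{-τ w}` of the masses of a gamma process. -/
def levyIntensity (α τ w : ℝ) : ℝ := α * w⁻¹ * Real.exp (-(τ * w))

/-- `ψ(z) = ∫₀^∞ (1 - e^{-zw}) λ(w) dw`. -/
def laplaceExponent (lam : ℝ → ℝ) (z : ℝ) : ℝ :=
  ∫ w in Ioi 0, (1 - Real.exp (-(z * w))) * lam w

/-- `κ(n, z) = ∫₀^∞ wⁿ e^{-zw} λ(w) dw`. -/
def tiltedMoment (lam : ℝ → ℝ) (n : ℕ) (z : ℝ) : ℝ :=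
  ∫ w in Ioi 0, w ^ n * Real.exp (-(z * w)) * lam w

/-- The items that are still available at stage `i` of the list `y`. -/
def remaining {X : Type*} {m : ℕ} (y : Fin m → X) (i : Fin m) : Set X :=
  {x | ∀ j, j < i → y j ≠ x}

open Classical in
/-- The Plackett--Luce law of a top-`m` list, given the rating measure `G`: the `i`-th item is
drawn from `G` with the items already picked removed, and normalised. So its conditional density
with respect to `G` is `1 / G(remaining y i)` on `remaining y i`, and `0` elsewhere. -/
def plackettLuce {X : Type*} [MeasurableSpace X] (m : ℕ) (G : Measure X) :
    Measure (Fin m → X) :=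
  (Measure.pi fun _ : Fin m => G).withDensity fun y =>
    ∏ i, if y i ∈ remaining y i then (G (remaining y i))⁻¹ else 0

/-- The mass of a single list of distinct items under the Plackett--Luce law:
`∏ᵢ G({yᵢ}) / G(X ∖ {y₁, …, yᵢ₋₁})`. -/
theorem plackettLuce_singleton {X : Type*} [MeasurableSpace X] [MeasurableSingletonClass X]
    (m : ℕ) (G : Measure X) [IsFiniteMeasure G] (y : Fin m → X) (hy : Function.Injective y) :
    plackettLuce m G {y} = ∏ i, G {y i} / G (remaining y i) := by
  have h : ∀ i, y i ∈ remaining y i := fun i j hj e => hj.ne (hy e)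
  rw [plackettLuce, withDensity_apply _ (measurableSet_singleton y), lintegral_singleton,
    Measure.pi_singleton, ← Finset.prod_mul_distrib]
  refine Finset.prod_congr rfl fun i _ => ?_
  rw [if_pos (h i), mul_comm, div_eq_mul_inv]

/-- The conditional law, given `G`, of one top-`m` list `y` together with its latent
variables `z`: the list has the Plackett--Luce law and, given the list, the `zᵢ` are independent,
exponential with rate `G(X ∖ {y₁, …, yᵢ₋₁})`. -/
def rankingLaw {X : Type*} [MeasurableSpace X] (m : ℕ) (G : Measure X) :
    Measure ((Fin m → X) × (Fin m → ℝ)) :=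
  ((plackettLuce m G).prod volume).withDensity fun p =>
    ∏ i, exponentialPDF (G (remaining p.1 i)).toReal (p.2 i)

/-- `Y` (the `L` partial rankings) and `Z` (the latent variables) follow the nonparametric
Plackett--Luce model with random rating measure `G`: given `G`, the `L` pairs `(Y_ℓ, Z_ℓ)` are
independent, each with law `rankingLaw m G`. -/
structure IsPlackettLuceSample {Ω X : Type*} [MeasurableSpace Ω] [MeasurableSpace X] {L m : ℕ}
    (G : Ω → Measure X) (Y : Ω → Fin L → Fin m → X) (Z : Ω → Fin L → Fin m → ℝ)
    (P : Measure Ω) : Prop where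
  measurable_Y : Measurable Y
  measurable_Z : Measurable Z
  condLaw : ∀ (A : Set (Measure X)) (B : Set (Fin L → (Fin m → X) × (Fin m → ℝ))),
    MeasurableSet A → MeasurableSet B →
    P {ω | G ω ∈ A ∧ (fun l => (Y ω l, Z ω l)) ∈ B} =
      ∫⁻ ω in {ω | G ω ∈ A}, Measure.pi (fun _ : Fin L => rankingLaw m (G ω)) B ∂P

open Classical in
/-- The set `{X*₁, …, X*_K}` of unique items among the `L` lists. -/
def uniqueItems {X : Type*} {L m : ℕ} (Y : Fin L → Fin m → X) : Finset X :=
  Finset.univ.image fun q : Fin L × Fin m => Y q.1 q.2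

open Classical in
/-- The number of occurrences of the item `x` among the `L` lists. -/
def occurrences {X : Type*} {L m : ℕ} (Y : Fin L → Fin m → X) (x : X) : ℕ :=
  (Finset.univ.filter fun q : Fin L × Fin m => Y q.1 q.2 = x).card

open Classical in
/-- The occurrence indicator `δ_{ℓ i}` of the item `x`: `0` if `x` is listed before place `i` in
list `ℓ`, and `1` otherwise. -/
def notYetListed {X : Type*} {L m : ℕ} (Y : Fin L → Fin m → X) (x : X)
    (l : Fin L) (i : Fin m) : ℝ :=
  if ∃ j, j < i ∧ Y l j = x then 0 else 1

open Classical in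
/-- The density `e^{-ψ(∑ Z)} ∏ₖ h(X*ₖ) κ(nₖ, ∑ δ Z)` at data `(Y, Z)`. Admissible data have
no item twice in the same list, and nonnegative durations; the density is `0` off these. -/
def marginalDensity {X : Type*} {L m : ℕ} (lam : ℝ → ℝ) (h : X → ENNReal)
    (p : (Fin L → Fin m → X) × (Fin L → Fin m → ℝ)) : ENNReal :=
  if (∀ l, Function.Injective (p.1 l)) ∧ (∀ l i, 0 ≤ p.2 l i) then
    ENNReal.ofReal (Real.exp (-laplaceExponent lam (∑ l, ∑ i, p.2 l i))) *
      ∏ x ∈ uniqueItems p.1, h x * ENNReal.ofReal (tiltedMoment lam (occurrences p.1 x)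
        (∑ l, ∑ i, notYetListed p.1 x l i * p.2 l i))
  else 0

open Classical in
/-- The reference measure for `L` lists of `m` items with ties: for each tie pattern (an
equivalence relation on the `L m` places) the unique items are integrated with respect to
independent copies of `μ`, and the contributions of all patterns are added. -/
def tiedMeasure {X : Type*} [MeasurableSpace X] (L m : ℕ) (μ : Measure X) :
    Measure (Fin L → Fin m → X) :=
  Measure.sum fun s : Setoid (Fin L × Fin m) =>
    (Measure.pi fun _ : Quotient s => μ).map
      fun (x : Quotient s → X) (l : Fin L) (i : Fin m) => x (Quotient.mk s (l, i))

end

open Filter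

open scoped ENNReal Topology

/-! Given `G`, the Plackett--Luce normaliser of each stage cancels the rate in front of the
exponential density of its duration. Relative to `G^{Lm} ⊗ dz` the data therefore have density `1{no
repetition} exp (-∑ z_p G(remaining at p))` on nonnegative durations. The exponent is `-∫ T_y dG`,
where `T_y(x)` is the total duration of the stages at which `x` is available
(`rankingLaw_eq_withDensity`, `pi_rankingLaw_prod`). It remains to average `exp (-∫ T_y dG)
G^{Lm}(dy)` over `G`.

For a fixed simple tilt `f > -τ` in place of `T_y`, the average is `exp (-∫ ψ(f) dH)` times the sum,
over the partitions of the places, of `∏_B κ(|B|, f(x_B)) H(dx_B)` (`integral_prod_mul_exp`,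
`lintegral_exp_mul_lintegral_pi`). The proof is an induction on the number of places and needs no
Poisson representation. Without places the formula is the Laplace functional, which follows from
independence over the level sets of `f`. Replacing `f` by `f - t 1_A` and differentiating at `t = 0`
brings down one more factor `G(A)`. As `ψ' = κ(1, ·)` and `κ(n, ·)' = -κ(n + 1, ·)`, differentiating
the exponential makes the new place a block of its own, and differentiating a factor `κ` adds it to
an existing block. These are all the partitions of the enlarged set of places.

The actual tilt `T_y` depends on `y`. A measurable diagonal provides finite partitions into cells
that eventually separate any two points. When items are read only up to their cells, finitely many
tilts occur and the formula applies to each (`lintegral_cells`); dominated convergence then refines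
the cells (`lintegral_availableTime`). Absence of atoms enters twice: `T_y = ∑ z` holds `H`-almost
everywhere, which gives `e^{-ψ(∑ z)}`, and the items of different blocks are almost surely distinct,
so block sizes are the counts `n_k`. -/

/-! ### Separating cells from a measurable diagonal -/

/-- A set in a product of measurable spaces is determined by countably many measurable sets. -/
theorem exists_countable_separating_of_measurableSet_prod {X : Type*} [MeasurableSpace X]
    {S : Set (X × X)} (hS : MeasurableSet S) :
    ∃ A : ℕ → Set X, (∀ n, MeasurableSet (A n)) ∧
      ∀ x x' y, (∀ n, x ∈ A n ↔ x' ∈ A n) → ((x, y) ∈ S ↔ (x', y) ∈ S) := by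
  rw [← generateFrom_prod] at hS
  induction S, hS using MeasurableSpace.generateFrom_induction with
  | hC t ht _ =>
    obtain ⟨A, hA, B, hB, rfl⟩ := ht
    refine ⟨fun _ => A, fun _ => hA, fun x x' y h => ?_⟩
    simp [h 0]
  | empty => exact ⟨fun _ => ∅, fun _ => .empty, by simp⟩
  | compl t _ ih =>
    obtain ⟨A, hA, h⟩ := ih
    exact ⟨A, hA, fun x x' y hx => not_congr (h x x' y hx)⟩
  | iUnion s _ ih =>
    choose A hA h using ih
    refine ⟨fun n => A n.unpair.1 n.unpair.2, fun n => hA _ _, fun x x' y hx => ?_⟩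
    simp only [mem_iUnion]
    refine exists_congr fun i => h i x x' y fun n => ?_
    simpa using hx (Nat.pair i n)

/-- A measurable space with measurable diagonal has an increasing sequence of finite measurable
partitions that separates points. -/
theorem exists_separating_cells (X : Type*) [MeasurableSpace X] [MeasurableEq X] :
    ∃ c : (n : ℕ) → X → (Fin n → Bool), (∀ n, Measurable (c n)) ∧
      (∀ x y n k, n ≤ k → c n x ≠ c n y → c k x ≠ c k y) ∧
      ∀ x y, x ≠ y → ∃ n, c n x ≠ c n y := by
  classical
  obtain ⟨A, hA, h⟩ := exists_countable_separating_of_measurableSet_prod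
    (measurableSet_diagonal (α := X))
  refine ⟨fun n x i => decide (x ∈ A i), fun n => ?_, fun x y n k hnk => mt fun hk => ?_,
    fun x y hxy => ?_⟩
  · refine measurable_pi_lambda _ fun i => ?_
    refine measurable_to_bool ?_
    convert hA i using 1
    ext x; simp
  · ext i
    exact congrFun hk (Fin.castLE hnk i) ▸ rfl
  · by_contra! hc
    refine hxy ?_
    have := (h x y y fun n => ?_).2 (by simp)
    · simpa using this
    -- The set `A n` first enters in `c (n + 1)`, as its last coordinate.
    · simpa using congrFun (hc (n + 1)) (Fin.last n)

/-! ### Product measures and kernels -/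

theorem lintegral_fin_pi_prod {n : ℕ} {E : Fin n → Type*} {mE : ∀ i, MeasurableSpace (E i)}
    {μ : (i : Fin n) → Measure (E i)} [∀ i, SigmaFinite (μ i)] (f : (i : Fin n) → E i → ℝ≥0∞)
    (hf : ∀ i, Measurable (f i)) :
    ∫⁻ x : (i : Fin n) → E i, ∏ i, f i (x i) ∂(Measure.pi μ) = ∏ i, ∫⁻ x, f i x ∂(μ i) := by
  induction n with
  | zero => simp
  | succ n ih =>
    have h := (measurePreserving_piFinSuccAbove μ 0).lintegral_comp_emb
      (MeasurableEquiv.measurableEmbedding _)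
      (fun x : E 0 × ((i : Fin n) → E i.succ) => f 0 x.1 * ∏ i : Fin n, f i.succ (x.2 i))
    simp_rw [Fin.prod_univ_succ]
    refine h.trans ?_
    refine (lintegral_prod_mul (μ := μ 0) (ν := Measure.pi fun i : Fin n => μ i.succ) (f := f 0)
      (g := fun x => ∏ i : Fin n, f i.succ (x i)) (hf 0).aemeasurable ?_).trans ?_
    · refine (Finset.measurable_fun_prod _ fun i _ => ?_).aemeasurable
      exact (hf i.succ).comp (measurable_pi_apply i)
    · rw [ih (fun i => f i.succ) fun i => hf i.succ]

/-- Tonelli's theorem for a product of functions of the coordinates. -/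
theorem lintegral_pi_prod {ι : Type*} [Fintype ι] {E : ι → Type*}
    {mE : ∀ i, MeasurableSpace (E i)} {μ : (i : ι) → Measure (E i)} [∀ i, SigmaFinite (μ i)]
    (f : (i : ι) → E i → ℝ≥0∞) (hf : ∀ i, Measurable (f i)) :
    ∫⁻ x : (i : ι) → E i, ∏ i, f i (x i) ∂(Measure.pi μ) = ∏ i, ∫⁻ x, f i x ∂(μ i) := by
  let e := (Fintype.equivFin ι).symm
  rw [← (measurePreserving_piCongrLeft _ e).lintegral_comp_emb
    (MeasurableEquiv.measurableEmbedding _)]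
  simp_rw [← e.prod_comp, MeasurableEquiv.coe_piCongrLeft, Equiv.piCongrLeft_apply_apply]
  exact lintegral_fin_pi_prod (fun i => f (e i)) fun i => hf _

/-- A product of measures with densities has the product density. -/
theorem pi_withDensity {ι : Type*} [Fintype ι] {E : ι → Type*}
    {mE : ∀ i, MeasurableSpace (E i)} {μ : (i : ι) → Measure (E i)} [∀ i, SigmaFinite (μ i)]
    (f : (i : ι) → E i → ℝ≥0∞) (hf : ∀ i, Measurable (f i))
    [∀ i, SigmaFinite ((μ i).withDensity (f i))] :
    Measure.pi (fun i => (μ i).withDensity (f i)) =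
      (Measure.pi μ).withDensity fun x => ∏ i, f i (x i) := by
  refine Measure.pi_eq fun s hs => ?_
  rw [withDensity_apply _ (MeasurableSet.univ_pi hs), ← lintegral_indicator (.univ_pi hs)]
  simp_rw [withDensity_apply _ (hs _), ← lintegral_indicator (hs _)]
  rw [← lintegral_pi_prod (fun i => (s i).indicator (f i)) fun i => (hf i).indicator (hs i)]
  refine lintegral_congr fun x => ?_
  by_cases hx : x ∈ univ.pi s
  · rw [indicator_of_mem hx]
    exact Finset.prod_congr rfl fun i _ => (indicator_of_mem (hx i (mem_univ _)) _).symm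
  · rw [indicator_of_notMem hx]
    obtain ⟨i, hi⟩ : ∃ i, x i ∉ s i := by simpa using hx
    exact (Finset.prod_eq_zero (Finset.mem_univ i) (indicator_of_notMem hi _)).symm

/-- A product measure over `ι × κ` is an iterated product measure. -/
theorem pi_map_curry {ι κ X : Type*} [Fintype ι] [Fintype κ] [MeasurableSpace X] (μ : Measure X)
    [SigmaFinite μ] :
    (Measure.pi fun _ : ι × κ => μ).map (MeasurableEquiv.curry ι κ X) =
      Measure.pi fun _ : ι => Measure.pi fun _ : κ => μ := by
  rw [MeasurableEquiv.map_apply_eq_iff_map_symm_apply_eq, eq_comm]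
  refine (Measure.pi_eq fun s hs => ?_).symm
  rw [MeasurableEquiv.map_apply]
  have : (MeasurableEquiv.curry ι κ X).symm ⁻¹' univ.pi s =
      univ.pi fun i => univ.pi fun k => s (i, k) := by
    ext y
    simp [MeasurableEquiv.curry, Function.uncurry]
  rw [this, Measure.pi_pi]
  simp_rw [Measure.pi_pi, Fintype.prod_prod_type]

/-- A measurable family of finite measures is an s-finite kernel. -/
theorem isSFiniteKernel_of_isFiniteMeasure {Ω E : Type*} [MeasurableSpace Ω] [MeasurableSpace E]
    (κ : Kernel Ω E) [∀ ω, IsFiniteMeasure (κ ω)] : IsSFiniteKernel κ := by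
  classical
  have hm : Measurable fun ω => κ ω univ := Kernel.measurable_coe κ .univ
  -- The total masses need not be bounded uniformly, so the parameter space is cut according to
  -- their integer part; on each piece the mass is at most `n + 1`.
  have hN : Measurable fun ω => ⌊(κ ω univ).toReal⌋₊ := Nat.measurable_floor.comp hm.ennreal_toReal
  have hS : ∀ n : ℕ, MeasurableSet {ω | ⌊(κ ω univ).toReal⌋₊ = n} := fun n =>
    hN (measurableSet_singleton n)
  have hfin : ∀ n : ℕ, IsFiniteKernel (Kernel.piecewise (hS n) κ 0) := fun n => by
    refine ⟨n + 1, by simp, fun ω => ?_⟩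
    rw [Kernel.piecewise_apply]
    split_ifs with h
    · rw [← ENNReal.ofReal_toReal (measure_ne_top (κ ω) univ)]
      have := (Nat.lt_floor_add_one (κ ω univ).toReal).le
      rw [show ⌊(κ ω univ).toReal⌋₊ = n from h] at this
      exact (ENNReal.ofReal_le_ofReal this).trans (by
        rw [ENNReal.ofReal_add (by positivity) zero_le_one]; simp)
    · simp
  have hsum : κ = Kernel.sum fun n => Kernel.piecewise (hS n) κ 0 := by
    ext ω s hs
    rw [Kernel.sum_apply' _ _ hs, tsum_eq_single ⌊(κ ω univ).toReal⌋₊]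
    · simp [Kernel.piecewise_apply]
    · intro n hn
      simp [Kernel.piecewise_apply, hn.symm]
  rw [hsum]
  infer_instance

/-- Finite measures on a finite product agree when they agree on measurable boxes. -/
theorem ext_of_univ_pi {ι : Type*} [Fintype ι] {E : ι → Type*} [∀ i, MeasurableSpace (E i)]
    (μ ν : Measure (∀ i, E i)) [IsFiniteMeasure μ]
    (h : ∀ s : ∀ i, Set (E i), (∀ i, MeasurableSet (s i)) → μ (univ.pi s) = ν (univ.pi s)) :
    μ = ν := by
  refine ext_of_generate_finite _ generateFrom_pi.symm isPiSystem_pi ?_ ?_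
  · rintro _ ⟨s, hs, rfl⟩
    exact h s fun i => hs i (mem_univ _)
  · simpa using h (fun _ => univ) fun _ => .univ

/-! ### Integrals of the Lévy intensity -/

/-- The moment `α Γ(n) / (u + τ)ⁿ` of the Lévy intensity of a gamma process tilted by `u`. -/
noncomputable def gammaMoment (α τ : ℝ) (n : ℕ) (u : ℝ) : ℝ := α * Real.Gamma n / (u + τ) ^ n

/-- The Laplace exponent `α log (1 + u / τ)` of a gamma process. -/
noncomputable def gammaExponent (α τ u : ℝ) : ℝ := α * Real.log (1 + u / τ)

/-- The bound `1 - e^{-zw} ≤ zw` cancels the singularity `w⁻¹` and leaves the dominating function `z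
α e^{-τw}`. -/
theorem integrableOn_laplaceExponent {α τ z : ℝ} (hα : 0 < α) (hτ : 0 < τ) (hz : 0 ≤ z) :
    IntegrableOn (fun w => (1 - Real.exp (-(z * w))) * levyIntensity α τ w) (Ioi 0) := by
  have h1 : IntegrableOn (fun w : ℝ => z * α * Real.exp (-τ * w)) (Ioi 0) :=
    (integrableOn_exp_mul_Ioi (by linarith) 0).const_mul _
  refine Integrable.mono' h1 ?_ ?_
  · unfold levyIntensity
    exact Measurable.aestronglyMeasurable (by fun_prop)
  · refine (ae_restrict_iff' measurableSet_Ioi).2 (ae_of_all _ fun w (hw : 0 < w) => ?_)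
    have h2 : 1 - Real.exp (-(z * w)) ≤ z * w := by
      have := Real.add_one_le_exp (-(z * w)); linarith
    have h3 : 0 ≤ 1 - Real.exp (-(z * w)) := by
      have : Real.exp (-(z * w)) ≤ 1 := Real.exp_le_one_iff.2 (by nlinarith)
      linarith
    rw [levyIntensity, Real.norm_of_nonneg (by positivity)]
    calc (1 - Real.exp (-(z * w))) * (α * w⁻¹ * Real.exp (-(τ * w)))
        ≤ (z * w) * (α * w⁻¹ * Real.exp (-(τ * w))) := by gcongr
      _ = _ := by rw [neg_mul]; field_simp

/-- This is the Frullani integral of `e^{-x}` with scales `τ` and `τ + z`, whose boundary values are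
`1` at `0` and `0` at infinity. -/
theorem laplaceExponent_levyIntensity {α τ z : ℝ} (hα : 0 < α) (hτ : 0 < τ) (hz : 0 ≤ z) :
    laplaceExponent (levyIntensity α τ) z = gammaExponent α τ z := by
  have hint := (integrableOn_laplaceExponent hα hτ hz).const_mul α⁻¹
  have heq : ∀ w : ℝ, α⁻¹ * ((1 - Real.exp (-(z * w))) * levyIntensity α τ w) =
      w⁻¹ • ((fun x => Real.exp (-x)) (τ * w) - (fun x => Real.exp (-x)) ((τ + z) * w)) := by
    intro w
    have : Real.exp (-((τ + z) * w)) = Real.exp (-(z * w)) * Real.exp (-(τ * w)) := by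
      rw [← Real.exp_add]; ring_nf
    simp only [levyIntensity, this, smul_eq_mul]
    field_simp
  have hcont : Filter.Tendsto (fun x : ℝ => Real.exp (-x)) (nhdsWithin 0 (Ioi 0)) (nhds 1) := by
    have h := (by fun_prop : Continuous fun x : ℝ => Real.exp (-x)).tendsto 0
    rw [neg_zero, Real.exp_zero] at h
    exact h.mono_left nhdsWithin_le_nhds
  have hF := Frullani.integral_Ioi_eq (f := fun x : ℝ => Real.exp (-x)) (L := 1) (R := 0)
    ((by fun_prop : Continuous fun x : ℝ => Real.exp (-x)).locallyIntegrable.locallyIntegrableOn _)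
    hτ (by linarith : 0 < τ + z)
    hcont
    (Real.tendsto_exp_neg_atTop_nhds_zero)
    (by simp_rw [heq] at hint; exact hint)
  simp_rw [← heq] at hF
  rw [integral_const_mul] at hF
  rw [laplaceExponent, gammaExponent]
  rw [show (τ + z) / τ = 1 + z / τ by field_simp] at hF
  simp only [sub_zero, smul_eq_mul, mul_one] at hF
  rw [← hF]; field_simp

/-- One factor `w` cancels `w⁻¹`, which is where `1 ≤ n` is needed; the rest is Euler's integral
with rate `z + τ`. -/
theorem tiltedMoment_levyIntensity {α τ z : ℝ} (hτ : 0 < τ) {n : ℕ}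
    (hn : 1 ≤ n) (hz : 0 ≤ z) :
    tiltedMoment (levyIntensity α τ) n z = gammaMoment α τ n z := by
  have h := Real.integral_rpow_mul_exp_neg_mul_Ioi (a := n) (r := z + τ)
    (by exact_mod_cast hn) (by linarith)
  rw [tiltedMoment, gammaMoment, mul_div_assoc]
  rw [Real.rpow_natCast, one_div, inv_pow] at h
  rw [div_eq_inv_mul, ← h, ← integral_const_mul]
  refine setIntegral_congr_fun measurableSet_Ioi fun w (hw : 0 < w) => ?_
  have : Real.exp (-((z + τ) * w)) = Real.exp (-(z * w)) * Real.exp (-(τ * w)) := by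
    rw [← Real.exp_add]; ring_nf
  obtain ⟨k, rfl⟩ : ∃ k, n = k + 1 := ⟨n - 1, by omega⟩
  simp only [levyIntensity, this]
  rw [show ((k + 1 : ℕ) : ℝ) - 1 = (k : ℕ) by push_cast; ring, Real.rpow_natCast]
  field_simp
  ring

theorem gammaMoment_pos {α τ z : ℝ} (hα : 0 < α) (hz : -τ < z) {n : ℕ} (hn : 1 ≤ n) :
    0 < gammaMoment α τ n z := by
  have := Real.Gamma_pos_of_pos (s := n) (by exact_mod_cast hn)
  have : 0 < z + τ := by linarith
  unfold gammaMoment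
  positivity

/-- A non-integrable function has Bochner integral `0`, whereas the closed form just found is
positive. -/
theorem integrableOn_tiltedMoment {α τ z : ℝ} (hα : 0 < α) (hτ : 0 < τ) {n : ℕ}
    (hn : 1 ≤ n) (hz : 0 ≤ z) :
    IntegrableOn (fun w => w ^ n * Real.exp (-(z * w)) * levyIntensity α τ w) (Ioi 0) := by
  by_contra h
  have h1 := tiltedMoment_levyIntensity (α := α) hτ hn hz
  rw [tiltedMoment, integral_undef h] at h1
  exact (gammaMoment_pos hα (by linarith) hn).ne h1

/-- Together with `hasDerivAt_gammaMoment` this drives the induction on places. Both hold on all of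
`(-τ, ∞)`, so two-sided perturbations of a tilt are allowed. -/
theorem hasDerivAt_gammaExponent {α τ u : ℝ} (hτ : 0 < τ) (hu : -τ < u) :
    HasDerivAt (gammaExponent α τ) (gammaMoment α τ 1 u) u := by
  have h0 : u + τ ≠ 0 := by linarith
  have h1 : (1 : ℝ) + u / τ ≠ 0 := by
    rw [show 1 + u / τ = (u + τ) / τ by field_simp; ring]; positivity
  have : HasDerivAt (gammaExponent α τ) _ u :=
    ((((hasDerivAt_id u).div_const τ).const_add 1).log h1).const_mul α
  refine this.congr_deriv ?_
  simp only [gammaMoment, id]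
  rw [show 1 + u / τ = (u + τ) / τ by field_simp; ring]
  simp
  field_simp

theorem hasDerivAt_gammaMoment {α τ u : ℝ} {n : ℕ} (hn : 1 ≤ n) (hu : -τ < u) :
    HasDerivAt (gammaMoment α τ n) (-gammaMoment α τ (n + 1) u) u := by
  have h0 : u + τ ≠ 0 := by linarith
  have : HasDerivAt (gammaMoment α τ n) _ u :=
    ((((hasDerivAt_id u).add_const τ).pow n).inv (pow_ne_zero n h0)).const_mul
      (α * Real.Gamma n)
  refine this.congr_deriv ?_
  obtain ⟨k, rfl⟩ : ∃ k, n = k + 1 := ⟨n - 1, by omega⟩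
  simp only [gammaMoment, id]
  have : Real.Gamma ((k + 1 + 1 : ℕ) : ℝ) = (k + 1 : ℕ) * Real.Gamma ((k + 1 : ℕ) : ℝ) := by
    rw [Nat.cast_add_one (k + 1)]
    exact Real.Gamma_add_one (by positivity)
  rw [this]
  simp only [Pi.pow_apply, Nat.add_sub_cancel]
  field_simp
  ring

/-! ### Laplace functional of a gamma process -/

/-- Exponential tilting by `v` changes the rate `τ` to `τ + v`; the constant `(τ / (τ + v))^a` is
the Laplace transform. -/
theorem gammaPDF_mul_exp {a τ v : ℝ} (hτ : 0 < τ) (hv : -τ < v) (x : ℝ) :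
    gammaPDF a τ x * ENNReal.ofReal (Real.exp (-(v * (ENNReal.ofReal x).toReal))) =
      ENNReal.ofReal (Real.exp (-(a * Real.log (1 + v / τ)))) * gammaPDF a (τ + v) x := by
  have h0 : 0 < τ + v := by linarith
  rcases lt_or_ge x 0 with hx | hx
  · simp [gammaPDF_of_neg hx]
  rw [gammaPDF_of_nonneg hx, gammaPDF_of_nonneg hx, ENNReal.toReal_ofReal hx,
    ← ENNReal.ofReal_mul' (Real.exp_pos _).le, ← ENNReal.ofReal_mul (Real.exp_pos _).le]
  congr 1
  have h1 : Real.exp (-(a * Real.log (1 + v / τ))) = τ ^ a / (τ + v) ^ a := by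
    rw [show 1 + v / τ = (τ + v) / τ by field_simp, Real.log_div h0.ne' hτ.ne',
      Real.rpow_def_of_pos hτ, Real.rpow_def_of_pos h0, ← Real.exp_sub]
    ring_nf
  have h2 : Real.exp (-((τ + v) * x)) = Real.exp (-(τ * x)) * Real.exp (-(v * x)) := by
    rw [← Real.exp_add]; ring_nf
  have h3 : (τ + v) ^ a ≠ 0 := (Real.rpow_pos_of_pos h0 a).ne'
  rw [h1, h2]
  field_simp

theorem lintegral_exp_gammaLaw {a τ v : ℝ} (ha : 0 ≤ a) (hτ : 0 < τ) (hv : -τ < v) :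
    ∫⁻ x, ENNReal.ofReal (Real.exp (-(v * x.toReal))) ∂gammaLaw a τ =
      ENNReal.ofReal (Real.exp (-(a * Real.log (1 + v / τ)))) := by
  have hm : Measurable fun x : ℝ≥0∞ => ENNReal.ofReal (Real.exp (-(v * x.toReal))) := by fun_prop
  rw [gammaLaw]
  split_ifs with h
  · rw [lintegral_dirac' _ hm]; simp [h]
  · have ha' : 0 < a := lt_of_le_of_ne ha (Ne.symm h)
    rw [lintegral_map hm ENNReal.measurable_ofReal, gammaMeasure,
      lintegral_withDensity_eq_lintegral_mul (f := gammaPDF a τ) _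
        (measurable_gammaPDFReal a τ).ennreal_ofReal
        (by fun_prop)]
    have : ∀ x, (gammaPDF a τ * fun x => ENNReal.ofReal
        (Real.exp (-(v * (ENNReal.ofReal x).toReal)))) x =
        ENNReal.ofReal (Real.exp (-(a * Real.log (1 + v / τ)))) * gammaPDF a (τ + v) x :=
      fun x => gammaPDF_mul_exp hτ hv x
    rw [lintegral_congr this, lintegral_const_mul (f := gammaPDF a (τ + v)) _
      (measurable_gammaPDFReal a _).ennreal_ofReal,
      lintegral_gammaPDF_eq_one ha' (by linarith), mul_one]

theorem gammaLaw_top (a τ : ℝ) : gammaLaw a τ {∞} = 0 := by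
  rw [gammaLaw]
  split_ifs
  · simp
  · rw [Measure.map_apply ENNReal.measurable_ofReal (measurableSet_singleton _)]
    rw [show ENNReal.ofReal ⁻¹' {∞} = ∅ by ext x; simp, measure_empty]

/-- As a finite sum over values, the integral can be turned into a product by independence and
differentiated termwise. -/
theorem setIntegral_comp_simpleFunc {X : Type*} [MeasurableSpace X] {μ : Measure X} [IsFiniteMeasure μ] (f : SimpleFunc X ℝ)
    (g : ℝ → ℝ) {B : Set X} (hB : MeasurableSet B) :
    ∫ x in B, g (f x) ∂μ = ∑ v ∈ f.range, (μ (B ∩ f ⁻¹' {v})).toReal * g v := by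
  have hU : B = ⋃ v ∈ f.range, B ∩ f ⁻¹' {v} := by
    ext x; simp
  have hint : ∀ v ∈ f.range, IntegrableOn (fun x => g (f x)) (B ∩ f ⁻¹' {v}) μ := fun v _ =>
    (integrableOn_const (C := g v) (measure_ne_top _ _)).congr_fun
      (fun x hx => by rw [show f x = v from hx.2]) (hB.inter (f.measurableSet_fiber v))
  conv_lhs => rw [hU]
  rw [integral_biUnion_finset _ (fun v _ => hB.inter (f.measurableSet_fiber v)) ?_ hint]
  · refine Finset.sum_congr rfl fun v _ => ?_
    rw [setIntegral_congr_fun (g := fun _ => g v) (hB.inter (f.measurableSet_fiber v))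
      (fun x hx => by rw [show f x = v from hx.2])]
    simp [Measure.real]
  · intro v _ w _ hvw
    exact (Disjoint.preimage _ (disjoint_singleton.2 hvw)).mono inter_subset_right
      inter_subset_right

namespace IsGammaProcess

variable {Ω X : Type*} [MeasurableSpace Ω] [MeasurableSpace X] {P : Measure Ω} {α τ : ℝ}
  {H : Measure X} {G : Ω → Measure X}

theorem measurable_apply (hG : IsGammaProcess α τ H G P) {A : Set X} (hA : MeasurableSet A) :
    Measurable fun ω => G ω A := (Measure.measurable_coe hA).comp hG.measurable

theorem ae_isFiniteMeasure (hG : IsGammaProcess α τ H G P) :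
    ∀ᵐ ω ∂P, IsFiniteMeasure (G ω) := by
  have h := gammaLaw_top (α * (H univ).toReal) τ
  rw [← hG.marginal univ .univ, Measure.map_apply (hG.measurable_apply .univ)
    (measurableSet_singleton _)] at h
  have h' : ∀ᵐ ω ∂P, G ω univ ≠ ∞ := by
    rw [ae_iff]; simpa [preimage] using h
  filter_upwards [h'] with ω hω using ⟨hω.lt_top⟩

theorem lintegral_exp_neg (hG : IsGammaProcess α τ H G P) (hα : 0 < α) (hτ : 0 < τ)
    {A : Set X} (hA : MeasurableSet A) {v : ℝ} (hv : -τ < v) :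
    ∫⁻ ω, ENNReal.ofReal (Real.exp (-(v * (G ω A).toReal))) ∂P =
      ENNReal.ofReal (Real.exp (-((H A).toReal * gammaExponent α τ v))) := by
  have h := lintegral_exp_gammaLaw (a := α * (H A).toReal) (by positivity) hτ hv
  rw [← hG.marginal A hA, lintegral_map (by fun_prop) (hG.measurable_apply hA)] at h
  rw [h, gammaExponent]
  ring_nf

/-- The level sets of `f` are disjoint, so their masses are independent and the expectation factors
into one-dimensional Laplace transforms. -/
theorem lintegral_exp_neg_integral (hG : IsGammaProcess α τ H G P) (hα : 0 < α) (hτ : 0 < τ)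
    [IsFiniteMeasure H] (f : SimpleFunc X ℝ) (hf : ∀ x, -τ < f x) :
    ∫⁻ ω, ENNReal.ofReal (Real.exp (-∫ x, f x ∂G ω)) ∂P =
      ENNReal.ofReal (Real.exp (-∫ x, gammaExponent α τ (f x) ∂H)) := by
  let e := f.range.equivFin.symm
  let A : Fin f.range.card → Set X := fun k => f ⁻¹' {(e k : ℝ)}
  have hA : ∀ k, MeasurableSet (A k) := fun k => f.measurableSet_fiber _
  have hind := hG.indep _ A hA fun j k hjk => by
    refine Disjoint.preimage _ (disjoint_singleton.2 fun h => hjk (e.injective (Subtype.ext h)))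
  have hind' := hind.comp (fun k x => ENNReal.ofReal (Real.exp (-((e k : ℝ) * x.toReal))))
    fun k => by fun_prop
  have hprod := lintegral_prod_eq_prod_lintegral_of_indepFun Finset.univ _ hind' fun k =>
    Measurable.comp (by fun_prop) (hG.measurable_apply (hA k))
  have hsum : ∀ F : ℝ → ℝ, ∑ v ∈ f.range, F v = ∑ k, F (e k) := fun F => by
    rw [← Finset.sum_coe_sort, ← e.sum_comp]
  have hmem : ∀ k, -τ < (e k : ℝ) := fun k => by
    obtain ⟨x, hx⟩ := SimpleFunc.mem_range.1 (e k).2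
    rw [← hx]; exact hf x
  calc ∫⁻ ω, ENNReal.ofReal (Real.exp (-∫ x, f x ∂G ω)) ∂P
      = ∫⁻ ω, ∏ k, ENNReal.ofReal (Real.exp (-((e k : ℝ) * (G ω (A k)).toReal))) ∂P := by
        refine lintegral_congr_ae ?_
        filter_upwards [hG.ae_isFiniteMeasure] with ω hω
        have := setIntegral_comp_simpleFunc (μ := G ω) f (fun v => v) .univ
        simp only [Measure.restrict_univ, univ_inter] at this
        rw [this, hsum fun v => (G ω (f ⁻¹' {v})).toReal * v, ← Finset.sum_neg_distrib,
          Real.exp_sum, ENNReal.ofReal_prod_of_nonneg fun _ _ => (Real.exp_pos _).le]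
        simp_rw [mul_comm]; rfl
    _ = ∏ k, ENNReal.ofReal (Real.exp (-((H (A k)).toReal * gammaExponent α τ (e k)))) := by
        refine hprod.trans (Finset.prod_congr rfl fun k _ => ?_)
        exact hG.lintegral_exp_neg hα hτ (hA k) (hmem k)
    _ = _ := by
        have := setIntegral_comp_simpleFunc (μ := H) f (gammaExponent α τ) .univ
        simp only [Measure.restrict_univ, univ_inter] at this
        rw [this, hsum fun v => (H (f ⁻¹' {v})).toReal * gammaExponent α τ v,
          ← Finset.sum_neg_distrib, Real.exp_sum,
          ENNReal.ofReal_prod_of_nonneg fun _ _ => (Real.exp_pos _).le]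

end IsGammaProcess

/-! ### Sums over set partitions, and adding one place -/

section SetoidSums

variable {ι κ R : Type*} [Fintype ι] [Fintype κ] [CommSemiring R]

open Classical in
noncomputable instance : Fintype (Setoid ι) :=
  Fintype.ofInjective (fun (s : Setoid ι) (p : ι × ι) => s p.1 p.2) fun _ _ h =>
    Setoid.ext fun a b => iff_of_eq (congrFun h (a, b))

open Classical in
/-- The product of `φ` over the blocks of the partition `s`. -/
noncomputable def blockProd (s : Setoid ι) (φ : Set ι → R) : R :=
  ∏ q : Quotient s, φ {i | Quotient.mk s i = q}

/-- The blocks of a kernel are the fibres, indexed bijectively by the values when `g` is onto. -/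
theorem blockProd_ker (φ : Set ι → R) {g : ι → κ} (hg : Function.Surjective g) :
    blockProd (Setoid.ker g) φ = ∏ k, φ (g ⁻¹' {k}) := by
  classical
  refine Fintype.prod_equiv (Setoid.quotientKerEquivOfSurjective g hg) _ _ fun q => ?_
  congr 1
  ext i
  induction q using Quotient.inductionOn with | _ j => ?_
  simp only [mem_ofPred_eq, mem_preimage, mem_singleton_iff]
  exact Quotient.eq

theorem sum_blockProd_equiv (e : ι ≃ κ) (φ : Set κ → R) :
    ∑ s : Setoid κ, blockProd s φ = ∑ s : Setoid ι, blockProd s fun B => φ (e '' B) := by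
  classical
  symm
  refine Fintype.sum_bijective (fun s : Setoid ι => Setoid.ker (Quotient.mk s ∘ e.symm)) ⟨?_, ?_⟩
    _ _ fun s => ?_
  · intro s t h
    ext a b
    have := congrArg (fun r : Setoid κ => r (e a) (e b)) h
    simpa [Setoid.ker_def, Quotient.eq] using this
  · intro t
    refine ⟨t.comap e, ?_⟩
    ext a b
    simp [Setoid.ker_def, Quotient.eq, Setoid.comap_rel]
  · rw [blockProd_ker _ (Quotient.mk_surjective.comp e.symm.surjective)]
    refine Finset.prod_congr rfl fun q _ => congrArg φ ?_
    ext k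
    simp [e.image_eq_preimage_symm]

/-- The partition of `Option ι` obtained from a partition of `ι` by inserting `none` into a block,
or as a new block. -/
def extendSetoid (p : Σ s : Setoid ι, Option (Quotient s)) : Setoid (Option ι) :=
  Setoid.ker fun x : Option ι => x.elim p.2 fun i => some (Quotient.mk p.1 i)

theorem extendSetoid_rel {ι : Type*} (p : Σ s : Setoid ι, Option (Quotient s)) (x y : Option ι) :
    extendSetoid p x y ↔ (x.elim p.2 fun i => some (Quotient.mk p.1 i)) =
      y.elim p.2 fun i => some (Quotient.mk p.1 i) := Iff.rfl

/-- The inverse restricts a partition to `ι` and records the block that `none` belongs to, or that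
`none` is alone. -/
theorem bijective_extendSetoid : Function.Bijective (extendSetoid (ι := ι)) := by
  constructor
  · rintro ⟨s, o⟩ ⟨t, o'⟩ h
    have hst : s = t := by
      ext a b
      have := congrArg (fun r : Setoid (Option ι) => r (some a) (some b)) h
      simpa [extendSetoid_rel, Quotient.eq] using this
    subst hst
    have : o = o' := by
      ext q
      induction q using Quotient.inductionOn with | _ i => ?_
      have := congrArg (fun r : Setoid (Option ι) => r none (some i)) h
      simpa [extendSetoid_rel] using this
    rw [this]
  · intro t
    by_cases h : ∃ i, t none (some i)
    · obtain ⟨i, hi⟩ := h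
      refine ⟨⟨t.comap some, some (Quotient.mk _ i)⟩, ?_⟩
      ext a b
      rcases a with _ | a <;> rcases b with _ | b <;>
        simp only [extendSetoid_rel, Option.elim, Option.some_inj, Quotient.eq,
          Setoid.comap_rel]
      · simp
      · exact ⟨fun h => t.trans hi h, fun h => t.trans (t.symm hi) h⟩
      · exact ⟨fun h => t.trans h (t.symm hi), fun h => t.trans h hi⟩
    · push Not at h
      refine ⟨⟨t.comap some, none⟩, ?_⟩
      ext a b
      rcases a with _ | a <;> rcases b with _ | b <;>
        simp only [extendSetoid_rel, Option.elim, Option.some_inj, Quotient.eq,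
          Setoid.comap_rel]
      · simp
      · simpa using h b
      · simpa using fun h' => h a (t.symm h')

theorem blockProd_extendSetoid_none (s : Setoid ι) (φ : Set (Option ι) → R) :
    blockProd (extendSetoid ⟨s, none⟩) φ = φ {none} * blockProd s fun B => φ (some '' B) := by
  classical
  rw [extendSetoid, blockProd_ker, Fintype.prod_option]
  · congr 1
    · congr 1
      ext x; cases x <;> simp
    · refine Finset.prod_congr rfl fun q _ => ?_
      congr 1
      ext x; cases x <;> simp
  · rintro (_ | q)
    · exact ⟨none, rfl⟩
    · induction q using Quotient.inductionOn with | _ i => exact ⟨some i, rfl⟩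

-- The factor of `b` is split off because the product rule produces exactly this shape: one block
-- altered, the others kept.
open Classical in
theorem blockProd_extendSetoid_some (s : Setoid ι) (b : Quotient s) (φ : Set (Option ι) → R) :
    blockProd (extendSetoid ⟨s, some b⟩) φ =
      (∏ q ∈ Finset.univ.erase b, φ (some '' {i | Quotient.mk s i = q})) *
        φ (insert none (some '' {i | Quotient.mk s i = b})) := by
  have : extendSetoid ⟨s, some b⟩ = Setoid.ker fun x : Option ι => x.elim b (Quotient.mk s) := by
    ext x y
    cases x <;> cases y <;> simp [extendSetoid_rel, Setoid.ker_def]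
  rw [this, blockProd_ker, ← Finset.prod_erase_mul _ _ (Finset.mem_univ b)]
  · congr 1
    · refine Finset.prod_congr rfl fun q hq => ?_
      congr 1
      ext x
      cases x
      · simpa using (Finset.ne_of_mem_erase hq).symm
      · simp
    · congr 1
      ext x; cases x <;> simp
  · intro q
    induction q using Quotient.inductionOn with | _ i => exact ⟨some i, rfl⟩

open Classical in
/-- The sum over the partitions of `Option ι`, in terms of the partitions of `ι`. -/
theorem sum_blockProd_option (φ : Set (Option ι) → R) :
    ∑ t : Setoid (Option ι), blockProd t φ =
      ∑ s : Setoid ι, (φ {none} * (blockProd s fun B => φ (some '' B)) +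
        ∑ b : Quotient s, (∏ q ∈ Finset.univ.erase b, φ (some '' {i | Quotient.mk s i = q})) *
          φ (insert none (some '' {i | Quotient.mk s i = b}))) := by
  rw [← bijective_extendSetoid.sum_comp, Fintype.sum_sigma]
  refine Finset.sum_congr rfl fun s _ => ?_
  rw [Fintype.sum_option, blockProd_extendSetoid_none]
  simp_rw [blockProd_extendSetoid_some]

end SetoidSums

/-! ### Perturbing a simple tilt on a set -/

namespace MeasureTheory.SimpleFunc

variable {X : Type*} [MeasurableSpace X]

/-- The simple function `f - t 1_A`. -/
noncomputable def subOn (f : SimpleFunc X ℝ) {A : Set X} (hA : MeasurableSet A) (t : ℝ) :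
    SimpleFunc X ℝ :=
  SimpleFunc.piecewise A hA (f.map fun v => v - t) f

theorem subOn_of_mem (f : SimpleFunc X ℝ) {A : Set X} (hA : MeasurableSet A) (t : ℝ) {x : X}
    (hx : x ∈ A) : f.subOn hA t x = f x - t := by
  simp [subOn, hx]

theorem subOn_of_notMem (f : SimpleFunc X ℝ) {A : Set X} (hA : MeasurableSet A) (t : ℝ) {x : X}
    (hx : x ∉ A) : f.subOn hA t x = f x := by
  simp [subOn, hx]

theorem integral_subOn {μ : Measure X} [IsFiniteMeasure μ] (f : SimpleFunc X ℝ) {A : Set X}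
    (hA : MeasurableSet A) (t : ℝ) :
    ∫ x, f.subOn hA t x ∂μ = ∫ x, f x ∂μ - t * (μ A).toReal := by
  have h : ∀ x, f.subOn hA t x = f x - A.indicator (fun _ => t) x := fun x => by
    by_cases hx : x ∈ A
    · rw [subOn_of_mem _ _ _ hx, indicator_of_mem hx]
    · rw [subOn_of_notMem _ _ _ hx, indicator_of_notMem hx, sub_zero]
  simp_rw [h]
  refine (MeasureTheory.integral_sub (f := fun x => f x) (g := A.indicator fun _ => t) (SimpleFunc.integrable_of_isFiniteMeasure f)
    ((integrable_const t).indicator hA)).trans ?_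
  rw [integral_indicator_const _ hA]
  simp [Measure.real, mul_comm]

/-- Outside `A` the integrand does not depend on `t`; inside, the integral is a finite sum over the
values of `f`. No differentiation under the integral sign is needed. -/
theorem hasDerivAt_setIntegral_subOn {μ : Measure X} [IsFiniteMeasure μ] {τ : ℝ} {g g' : ℝ → ℝ}
    (hg : ∀ u, -τ < u → HasDerivAt g (g' u) u) (f : SimpleFunc X ℝ) (hf : ∀ x, -τ < f x)
    {A B : Set X} (hA : MeasurableSet A) (hB : MeasurableSet B) :
    HasDerivAt (fun t => ∫ x in B, g (f.subOn hA t x) ∂μ) (-∫ x in B ∩ A, g' (f x) ∂μ) 0 := by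
  have h : ∀ t, ∫ x in B, g (f.subOn hA t x) ∂μ =
      ∑ v ∈ f.range, (μ (B ∩ A ∩ f ⁻¹' {v})).toReal * g (v - t) + ∫ x in B \ A, g (f x) ∂μ := by
    intro t
    rw [← setIntegral_comp_simpleFunc f (fun v => g (v - t)) (hB.inter hA),
      ← integral_inter_add_sdiff (f := fun x => g (f.subOn hA t x)) hA
        (SimpleFunc.integrable_of_isFiniteMeasure ((f.subOn hA t).map g)).integrableOn]
    congr 1
    · refine setIntegral_congr_fun (hB.inter hA) fun x hx => ?_
      simp [subOn_of_mem _ _ _ hx.2]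
    · refine setIntegral_congr_fun (hB.diff hA) fun x hx => ?_
      simp [subOn_of_notMem _ _ _ hx.2]
  simp_rw [h]
  refine HasDerivAt.add_const _ ?_
  rw [setIntegral_comp_simpleFunc f g' (hB.inter hA), ← Finset.sum_neg_distrib]
  refine HasDerivAt.fun_sum fun v hv => ?_
  obtain ⟨x, rfl⟩ := SimpleFunc.mem_range.1 hv
  have h1 : HasDerivAt g (g' (f x)) (f x - 0) := by simpa using hg _ (hf x)
  have := (h1.comp (0 : ℝ) ((hasDerivAt_id (0 : ℝ)).const_sub (f x))).const_mul
    (μ (B ∩ A ∩ f ⁻¹' {f x})).toReal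
  refine this.congr_deriv (by ring)

/-- A finite range gives a uniform margin, hence an interval of admissible perturbations around `0`.
-/
theorem exists_pos_le_of_lt (f : SimpleFunc X ℝ) {c : ℝ} (hf : ∀ x, c < f x) :
    ∃ ε > 0, ∀ x, c + ε ≤ f x := by
  rcases isEmpty_or_nonempty X with h | h
  · exact ⟨1, one_pos, fun x => h.elim x⟩
  · obtain ⟨v, hv, hmin⟩ := f.range.exists_min_image id
      ⟨_, f.mem_range_self h.some⟩
    obtain ⟨x, rfl⟩ := SimpleFunc.mem_range.1 hv
    exact ⟨f x - c, sub_pos.2 (hf x), fun y => by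
      have := hmin (f y) (SimpleFunc.mem_range_self f y)
      simp only [id] at this; linarith⟩

end MeasureTheory.SimpleFunc

/-! ### Tilted joint moments -/

/-- The contribution `∫ (∏_{i ∈ B} 1_{A i}) κ(|B|, f) dH` of a block `B` of tied places. -/
noncomputable def blockMoment {ι X : Type*} [MeasurableSpace X] (α τ : ℝ) (H : Measure X)
    (A : ι → Set X) (f : X → ℝ) (B : Set ι) : ℝ :=
  ∫ x in ⋂ i ∈ B, A i, gammaMoment α τ B.ncard (f x) ∂H

theorem blockMoment_nonneg {ι X : Type*} [MeasurableSpace X] {α τ : ℝ} (hα : 0 < α) {H : Measure X}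
    (A : ι → Set X) {f : X → ℝ} (hf : ∀ x, -τ < f x) {B : Set ι} (hB : 1 ≤ B.ncard) :
    0 ≤ blockMoment α τ H A f B :=
  integral_nonneg fun x => (gammaMoment_pos hα (hf x) hB).le

theorem one_le_ncard_block {ι : Type*} [Finite ι] (s : Setoid ι) (q : Quotient s) :
    1 ≤ ({i | Quotient.mk s i = q} : Set ι).ncard := by
  rw [Nat.one_le_iff_ne_zero, Ne, Set.ncard_eq_zero (Set.toFinite _)]
  induction q using Quotient.inductionOn with | _ i =>
  exact Set.nonempty_iff_ne_empty.1 ⟨i, rfl⟩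

namespace IsGammaProcess

variable {Ω X : Type*} [MeasurableSpace Ω] [MeasurableSpace X] {P : Measure Ω} {α τ : ℝ}
  {H : Measure X} {G : Ω → Measure X}

theorem aemeasurable_integral_simpleFunc (hG : IsGammaProcess α τ H G P) (f : SimpleFunc X ℝ) :
    AEMeasurable (fun ω => ∫ x, f x ∂G ω) P := by
  refine ⟨fun ω => ∑ v ∈ f.range, (G ω (f ⁻¹' {v})).toReal * v, ?_, ?_⟩
  · exact Finset.measurable_fun_sum _ fun v _ =>
      (hG.measurable_apply (f.measurableSet_fiber v)).ennreal_toReal.mul_const v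
  · filter_upwards [hG.ae_isFiniteMeasure] with ω hω
    have := setIntegral_comp_simpleFunc (μ := G ω) f (fun v => v) .univ
    simpa only [Measure.restrict_univ, univ_inter] using this

/-- The joint moments of a gamma process under exponential tilting, as sums over partitions. -/
theorem integral_prod_mul_exp (hG : IsGammaProcess α τ H G P) (hα : 0 < α) (hτ : 0 < τ)
    [IsFiniteMeasure H] (ι : Type) [Fintype ι] (A : ι → Set X) (hA : ∀ i, MeasurableSet (A i))
    (f : SimpleFunc X ℝ) (hf : ∀ x, -τ < f x) :
    Integrable (fun ω => (∏ i, (G ω (A i)).toReal) * Real.exp (-∫ x, f x ∂G ω)) P ∧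
      ∫ ω, (∏ i, (G ω (A i)).toReal) * Real.exp (-∫ x, f x ∂G ω) ∂P =
        Real.exp (-∫ x, gammaExponent α τ (f x) ∂H) *
          ∑ s : Setoid ι, blockProd s (blockMoment α τ H A f) := by
  classical
  -- The induction hypothesis is used at the perturbed tilts, so `f` must vary too.
  revert A f
  refine Fintype.induction_empty_option (P := fun ι _ => ∀ (A : ι → Set X),
    (∀ i, MeasurableSet (A i)) → ∀ (f : SimpleFunc X ℝ), (∀ x, -τ < f x) →
      Integrable (fun ω => (∏ i, (G ω (A i)).toReal) * Real.exp (-∫ x, f x ∂G ω)) P ∧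
      ∫ ω, (∏ i, (G ω (A i)).toReal) * Real.exp (-∫ x, f x ∂G ω) ∂P =
        Real.exp (-∫ x, gammaExponent α τ (f x) ∂H) *
          ∑ s : Setoid ι, blockProd s (blockMoment α τ H A f)) ?_ ?_ ?_ ι
  · intro ι κ _ e ih A hA f hf
    let _ : Fintype ι := Fintype.ofEquiv κ e.symm
    obtain ⟨h1, h2⟩ := ih (fun i => A (e i)) (fun i => hA _) f hf
    have hp : ∀ ω, ∏ i, (G ω (A (e i))).toReal = ∏ k, (G ω (A k)).toReal := fun ω =>
      e.prod_comp fun k => (G ω (A k)).toReal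
    simp_rw [hp] at h1 h2
    refine ⟨h1, h2.trans ?_⟩
    rw [sum_blockProd_equiv e]
    congr! 5 with s _ B
    rw [blockMoment, blockMoment, ncard_image_of_injective _ e.injective, biInter_image]
  · intro A hA f hf
    have hm : AEMeasurable (fun ω => Real.exp (-∫ x, f x ∂G ω)) P :=
      (hG.aemeasurable_integral_simpleFunc f).neg.exp
    have hL := hG.lintegral_exp_neg_integral hα hτ f hf
    have hsum : ∑ s : Setoid PEmpty, blockProd s (blockMoment α τ H A f) = 1 := by
      rw [Fintype.sum_eq_single (⊥ : Setoid PEmpty) fun s hs => (hs (Setoid.ext fun a => a.elim)).elim]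
      rw [blockProd]
      have : IsEmpty (Quotient (⊥ : Setoid PEmpty)) := ⟨fun q => q.out.elim⟩
      exact Fintype.prod_empty _
    simp only [Finset.univ_eq_empty, Finset.prod_empty, one_mul, hsum, mul_one]
    refine ⟨⟨hm.aestronglyMeasurable, ?_⟩, ?_⟩
    · rw [hasFiniteIntegral_iff_ofReal (ae_of_all _ fun _ => (Real.exp_pos _).le)]
      exact hL.trans_lt ENNReal.ofReal_lt_top
    · rw [integral_eq_lintegral_of_nonneg_ae (ae_of_all _ fun _ => (Real.exp_pos _).le)
        hm.aestronglyMeasurable]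
      exact (congrArg _ hL).trans (ENNReal.toReal_ofReal (Real.exp_pos _).le)
  · intro ι _ ih A hA f hf
    obtain ⟨ε, hε, hfε⟩ := f.exists_pos_le_of_lt hf
    have hA0 := hA none
    set A' : ι → Set X := fun i => A (some i) with hA'
    set W : Ω → ℝ := fun ω => (∏ i, (G ω (A' i)).toReal) * Real.exp (-∫ x, f x ∂G ω) with hW
    set U : Ω → ℝ := fun ω => (G ω (A none)).toReal with hU
    have hWm : AEMeasurable W P := by
      refine AEMeasurable.mul (Measurable.aemeasurable ?_)
        (hG.aemeasurable_integral_simpleFunc f).neg.exp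
      exact Finset.measurable_fun_prod _ fun i _ => (hG.measurable_apply (hA _)).ennreal_toReal
    have hW0 : ∀ ω, 0 ≤ W ω := fun ω =>
      mul_nonneg (Finset.prod_nonneg fun i _ => ENNReal.toReal_nonneg) (Real.exp_pos _).le
    have hft : ∀ t : ℝ, |t| < ε → ∀ x, -τ < f.subOn hA0 t x := fun t ht x => by
      have h1 := hfε x
      have h2 := (abs_lt.1 ht)
      by_cases hx : x ∈ A none
      · rw [SimpleFunc.subOn_of_mem _ _ _ hx]; linarith
      · rw [SimpleFunc.subOn_of_notMem _ _ _ hx]; linarith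
    have hWt : ∀ t : ℝ, (fun ω => (∏ i, (G ω (A' i)).toReal) *
        Real.exp (-∫ x, f.subOn hA0 t x ∂G ω)) =ᵐ[P] fun ω => W ω * Real.exp (t * U ω) := by
      intro t
      filter_upwards [hG.ae_isFiniteMeasure] with ω hω
      rw [SimpleFunc.integral_subOn, hW, mul_assoc, ← Real.exp_add]
      congr 2
      simp only [hU]; ring
    -- With the old factors and the tilt absorbed into `Q`, the wanted moment is the mean of `U`
    -- under `Q`, that is, the derivative at `0` of its moment generating function. Near `0` that
    -- function is known from the induction hypothesis at the tilt `f - t 1_A`.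
    set Q := P.withDensity fun ω => ENNReal.ofReal (W ω) with hQ
    have hQint : ∀ F : Ω → ℝ, Integrable F Q ↔ Integrable (fun ω => W ω * F ω) P := fun F => by
      rw [hQ, integrable_withDensity_iff_integrable_smul₀' hWm.ennreal_ofReal
        (ae_of_all _ fun _ => ENNReal.ofReal_lt_top)]
      simp_rw [ENNReal.toReal_ofReal (hW0 _), smul_eq_mul]
    have hQeq : ∀ F : Ω → ℝ, ∫ ω, F ω ∂Q = ∫ ω, W ω * F ω ∂P := fun F => by
      rw [hQ, integral_withDensity_eq_integral_toReal_smul₀ hWm.ennreal_ofReal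
        (ae_of_all _ fun _ => ENNReal.ofReal_lt_top)]
      simp_rw [ENNReal.toReal_ofReal (hW0 _), smul_eq_mul]
    have hexp : ∀ t : ℝ, |t| < ε → Integrable (fun ω => Real.exp (t * U ω)) Q := fun t ht =>
      (hQint _).2 (((ih A' (fun i => hA _) _ (hft t ht)).1).congr (hWt t))
    have hmgf : ∀ t : ℝ, |t| < ε → mgf U Q t =
        Real.exp (-∫ x, gammaExponent α τ (f.subOn hA0 t x) ∂H) *
          ∑ s : Setoid ι, blockProd s (blockMoment α τ H A' (f.subOn hA0 t)) := fun t ht => by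
      rw [mgf, hQeq, ← (ih A' (fun i => hA _) _ (hft t ht)).2]
      exact (integral_congr_ae (hWt t)).symm
    have hball : Metric.ball (0 : ℝ) ε ∈ nhds (0 : ℝ) := Metric.ball_mem_nhds _ hε
    have hint0 : (0 : ℝ) ∈ interior (integrableExpSet U Q) := by
      refine mem_interior_iff_mem_nhds.2 (Filter.mem_of_superset hball fun t ht => ?_)
      exact hexp t (by simpa using ht)
    have hUint : Integrable U Q := integrable_of_mem_interior_integrableExpSet hint0
    have hder := hasDerivAt_mgf hint0
    simp only [zero_mul, Real.exp_zero, mul_one] at hder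
    have hprod : ∀ ω, (∏ i, (G ω (A i)).toReal) * Real.exp (-∫ x, f x ∂G ω) = W ω * U ω :=
      fun ω => by
        rw [Fintype.prod_option, hW, hU]; ring
    simp_rw [hprod]
    refine ⟨(hQint U).1 hUint, ?_⟩
    rw [← hQeq U]
    have hexpo := (SimpleFunc.hasDerivAt_setIntegral_subOn (μ := H) (τ := τ)
      (fun u hu => hasDerivAt_gammaExponent (α := α) hτ hu) f hf hA0 .univ).neg.exp
    have hblock : ∀ B : Set ι, 1 ≤ B.ncard →
        HasDerivAt (fun t => blockMoment α τ H A' (f.subOn hA0 t) B)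
          (blockMoment α τ H A f (insert none (some '' B))) 0 := fun B hB => by
      have := SimpleFunc.hasDerivAt_setIntegral_subOn (μ := H) (τ := τ)
        (fun u hu => hasDerivAt_gammaMoment (α := α) hB hu) f hf hA0
        (B := ⋂ i ∈ B, A' i) (MeasurableSet.biInter (to_countable B) fun i _ => hA _)
      refine this.congr_deriv ?_
      rw [blockMoment, biInter_insert, biInter_image, inter_comm (A none),
        ncard_insert_of_notMem (by simp), ncard_image_of_injective _ (Option.some_injective _),
        integral_neg, neg_neg]
    -- The derivative of the first factor will match the new block `{none}`, that of the second the
    -- insertions of `none` into old blocks.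
    have hmul := hexpo.mul (HasDerivAt.fun_sum fun s (_ : s ∈ (Finset.univ : Finset (Setoid ι))) =>
      HasDerivAt.fun_finsetProd fun q (_ : q ∈ (Finset.univ : Finset (Quotient s))) =>
        hblock {i | Quotient.mk s i = q} (one_le_ncard_block s q))
    have heq : mgf U Q =ᶠ[nhds 0] fun t =>
        Real.exp (-∫ x, gammaExponent α τ (f.subOn hA0 t x) ∂H) *
          ∑ s : Setoid ι, blockProd s (blockMoment α τ H A' (f.subOn hA0 t)) :=
      Filter.mem_of_superset hball fun t ht => hmgf t (by simpa using ht)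
    have hsub0 : ∀ x, f.subOn hA0 0 x = f x := fun x => by
      by_cases hx : x ∈ A none
      · rw [SimpleFunc.subOn_of_mem _ _ _ hx, sub_zero]
      · rw [SimpleFunc.subOn_of_notMem _ _ _ hx]
    have hsub0' : ⇑(f.subOn hA0 0) = f := funext hsub0
    have himg : ∀ B : Set ι, blockMoment α τ H A f (some '' B) = blockMoment α τ H A' f B :=
      fun B => by
        rw [blockMoment, blockMoment, ncard_image_of_injective _ (Option.some_injective _),
          biInter_image]
    have huniq := (hder.congr_of_eventuallyEq heq.symm).unique
      (hmul.congr_of_eventuallyEq (Filter.Eventually.of_forall fun t => by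
        simp only [Measure.restrict_univ, Pi.mul_apply]; rfl))
    rw [huniq, sum_blockProd_option, Finset.sum_add_distrib, ← Finset.mul_sum]
    simp_rw [himg, hsub0', Measure.restrict_univ, univ_inter, smul_eq_mul]
    have hnone : blockMoment α τ H A f {none} = ∫ x in A none, gammaMoment α τ 1 (f x) ∂H := by
      simp [blockMoment]
    rw [hnone]
    simp only [blockProd, Pi.neg_apply, hsub0']
    ring

end IsGammaProcess

/-! ### Tilted moment measures -/

/-- The product of `n` copies of a measurable family of finite measures is a measurable family. -/
theorem measurable_pi_of_isFiniteMeasure {Ω X ι : Type*} [MeasurableSpace Ω] [MeasurableSpace X]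
    [Fintype ι] {G : Ω → Measure X} [∀ ω, IsFiniteMeasure (G ω)] (hG : Measurable G) :
    Measurable fun ω => Measure.pi fun _ : ι => G ω := by
  refine Measurable.measure_of_isPiSystem generateFrom_pi.symm isPiSystem_pi ?_ ?_
  · rintro _ ⟨s, hs, rfl⟩
    simp_rw [Measure.pi_pi]
    exact Finset.measurable_fun_prod _ fun i _ =>
      (Measure.measurable_coe (hs i (mem_univ _))).comp hG
  · simp_rw [Measure.pi_univ]
    exact Finset.measurable_fun_prod _ fun i _ => (Measure.measurable_coe .univ).comp hG

@[fun_prop]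
theorem measurable_gammaMoment (α τ : ℝ) (n : ℕ) : Measurable (gammaMoment α τ n) := by
  unfold gammaMoment; fun_prop

@[fun_prop]
theorem measurable_gammaExponent (α τ : ℝ) : Measurable (gammaExponent α τ) := by
  unfold gammaExponent; fun_prop

theorem gammaMoment_le {α τ u : ℝ} (hα : 0 < α) (hτ : 0 < τ) {n : ℕ} (hn : 1 ≤ n) (hu : 0 ≤ u) :
    gammaMoment α τ n u ≤ gammaMoment α τ n 0 := by
  have := Real.Gamma_pos_of_pos (s := n) (by exact_mod_cast hn)
  unfold gammaMoment
  gcongr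

theorem gammaExponent_nonneg {α τ u : ℝ} (hα : 0 < α) (hτ : 0 < τ) (hu : 0 ≤ u) :
    0 ≤ gammaExponent α τ u :=
  mul_nonneg hα.le (Real.log_nonneg (by have := div_nonneg hu hτ.le; linarith))

theorem gammaExponent_mono {α τ u v : ℝ} (hα : 0 < α) (hτ : 0 < τ) (hu : 0 ≤ u) (huv : u ≤ v) :
    gammaExponent α τ u ≤ gammaExponent α τ v := by
  unfold gammaExponent
  gcongr

/-- The measurable map that places the items `x` of the blocks of `s` at the places. -/
def placeItems {ι X : Type*} (s : Setoid ι) (x : Quotient s → X) (i : ι) : X := x (Quotient.mk s i)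

@[fun_prop]
theorem measurable_placeItems {ι X : Type*} [MeasurableSpace X] (s : Setoid ι) :
    Measurable (placeItems (X := X) s) :=
  measurable_pi_lambda _ fun _ => measurable_pi_apply _

namespace IsGammaProcess

variable {Ω X : Type*} [MeasurableSpace Ω] [MeasurableSpace X] {P : Measure Ω} {α τ : ℝ}
  {H : Measure X} {G : Ω → Measure X}

open Classical in
theorem lintegral_prod_mul_exp (hG : IsGammaProcess α τ H G P) (hα : 0 < α) (hτ : 0 < τ)
    [IsFiniteMeasure H] (ι : Type) [Fintype ι] (A : ι → Set X) (hA : ∀ i, MeasurableSet (A i))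
    (f : SimpleFunc X ℝ) (hf : ∀ x, -τ < f x) :
    ∫⁻ ω, ENNReal.ofReal (Real.exp (-∫ x, f x ∂G ω)) * ∏ i, G ω (A i) ∂P =
      ENNReal.ofReal (Real.exp (-∫ x, gammaExponent α τ (f x) ∂H)) *
        ∑ s : Setoid ι, ∏ q : Quotient s,
          ∫⁻ x in ⋂ i ∈ {i | Quotient.mk s i = q}, A i, ENNReal.ofReal
            (gammaMoment α τ ({i | Quotient.mk s i = q} : Set ι).ncard (f x)) ∂H := by
  obtain ⟨h1, h2⟩ := hG.integral_prod_mul_exp hα hτ ι A hA f hf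
  have h3 := ofReal_integral_eq_lintegral_ofReal h1 (ae_of_all _ fun ω =>
    mul_nonneg (Finset.prod_nonneg fun i _ => ENNReal.toReal_nonneg) (Real.exp_pos _).le)
  have hb : ∀ (s : Setoid ι) (q : Quotient s),
      0 ≤ blockMoment α τ H A f {i | Quotient.mk s i = q} := fun s q =>
    blockMoment_nonneg hα A hf (one_le_ncard_block s q)
  have h4 : ∫⁻ ω, ENNReal.ofReal (Real.exp (-∫ x, f x ∂G ω)) * ∏ i, G ω (A i) ∂P =
      ENNReal.ofReal (∫ ω, (∏ i, (G ω (A i)).toReal) * Real.exp (-∫ x, f x ∂G ω) ∂P) := by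
    rw [h3]
    refine lintegral_congr_ae ?_
    filter_upwards [hG.ae_isFiniteMeasure] with ω hω
    rw [ENNReal.ofReal_mul' (Real.exp_pos _).le, mul_comm,
      ENNReal.ofReal_prod_of_nonneg fun _ _ => ENNReal.toReal_nonneg]
    simp_rw [ENNReal.ofReal_toReal (measure_ne_top (G ω) _)]
  rw [h4, h2, ENNReal.ofReal_mul (Real.exp_pos _).le, ENNReal.ofReal_sum_of_nonneg]
  · congr 1
    refine Finset.sum_congr rfl fun s _ => ?_
    rw [blockProd, ENNReal.ofReal_prod_of_nonneg fun q _ => hb s q]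
    refine Finset.prod_congr rfl fun q _ => ?_
    rw [blockMoment, ofReal_integral_eq_lintegral_ofReal]
    · exact (SimpleFunc.integrable_of_isFiniteMeasure (f.map (gammaMoment α τ _))).integrableOn
    · exact ae_of_all _ fun x => (gammaMoment_pos hα (hf x) (one_le_ncard_block s q)).le
  · exact fun s _ => Finset.prod_nonneg fun q _ => hb s q

open Classical in
/-- The tilted moment measure of a gamma process, as a sum over tie patterns. -/
theorem lintegral_exp_mul_lintegral_pi (hG : IsGammaProcess α τ H G P) (hα : 0 < α) (hτ : 0 < τ)
    [IsFiniteMeasure H] [∀ ω, IsFiniteMeasure (G ω)] (ι : Type) [Fintype ι]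
    (f : SimpleFunc X ℝ) (hf : ∀ x, -τ < f x) {F : (ι → X) → ℝ≥0∞} (hF : Measurable F) :
    ∫⁻ ω, ENNReal.ofReal (Real.exp (-∫ x, f x ∂G ω)) * ∫⁻ y, F y ∂(Measure.pi fun _ => G ω) ∂P =
      ENNReal.ofReal (Real.exp (-∫ x, gammaExponent α τ (f x) ∂H)) *
        ∑ s : Setoid ι, ∫⁻ x : Quotient s → X, F (placeItems s x) * ∏ q, ENNReal.ofReal
          (gammaMoment α τ ({i | Quotient.mk s i = q} : Set ι).ncard (f (x q)))
            ∂(Measure.pi fun _ => H) := by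
  have hpi : Measurable fun ω => Measure.pi fun _ : ι => G ω :=
    measurable_pi_of_isFiniteMeasure hG.measurable
  have hfm : Measurable f := f.measurable
  have hw : AEMeasurable (fun ω => ENNReal.ofReal (Real.exp (-∫ x, f x ∂G ω))) P :=
    (hG.aemeasurable_integral_simpleFunc f).neg.exp.ennreal_ofReal
  let Q : Measure (ι → X) := (P.withDensity fun ω =>
    ENNReal.ofReal (Real.exp (-∫ x, f x ∂G ω))).bind fun ω => Measure.pi fun _ : ι => G ω
  have hQ : ∀ {F : (ι → X) → ℝ≥0∞}, Measurable F → ∫⁻ y, F y ∂Q =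
      ∫⁻ ω, ENNReal.ofReal (Real.exp (-∫ x, f x ∂G ω)) *
        ∫⁻ y, F y ∂(Measure.pi fun _ => G ω) ∂P := fun {F} hF => by
    rw [Measure.lintegral_bind hpi.aemeasurable hF.aemeasurable,
      lintegral_withDensity_eq_lintegral_mul₀ hw
        (g := fun ω => ∫⁻ y, F y ∂(Measure.pi fun _ : ι => G ω)) ((Measure.measurable_lintegral hF).comp hpi).aemeasurable]
    rfl
  let D : (s : Setoid ι) → Quotient s → X → ℝ≥0∞ := fun s q x => ENNReal.ofReal
    (gammaMoment α τ ({i | Quotient.mk s i = q} : Set ι).ncard (f x))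
  have hD : ∀ s q, Measurable (D s q) := fun s q => by fun_prop
  have hDf : ∀ (s : Setoid ι) (q : Quotient s), IsFiniteMeasure (H.withDensity (D s q)) :=
    fun s q => isFiniteMeasure_withDensity_ofReal
      (SimpleFunc.integrable_of_isFiniteMeasure (f.map (gammaMoment α τ _))).2
  let ν : Measure (ι → X) := ENNReal.ofReal (Real.exp (-∫ x, gammaExponent α τ (f x) ∂H)) •
    ∑ s : Setoid ι, (Measure.pi fun q => H.withDensity (D s q)).map (placeItems s)
  have hν : ∀ {F : (ι → X) → ℝ≥0∞}, Measurable F → ∫⁻ y, F y ∂ν =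
      ENNReal.ofReal (Real.exp (-∫ x, gammaExponent α τ (f x) ∂H)) *
        ∑ s : Setoid ι, ∫⁻ x : Quotient s → X, F (placeItems s x) * ∏ q, D s q (x q)
            ∂(Measure.pi fun _ => H) := fun {F} hF => by
    rw [lintegral_smul_measure, lintegral_finsetSum_measure, smul_eq_mul]
    congr 1
    refine Finset.sum_congr rfl fun s _ => ?_
    rw [lintegral_map hF (measurable_placeItems s), pi_withDensity _ (hD s),
      lintegral_withDensity_eq_lintegral_mul _ (by fun_prop) (by fun_prop)]
    simp only [Pi.mul_apply, mul_comm]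
  have : IsFiniteMeasure ν := by
    have : IsFiniteMeasure (∑ s : Setoid ι,
        (Measure.pi fun q => H.withDensity (D s q)).map (placeItems s)) := inferInstance
    exact Measure.smul_finite _ ENNReal.ofReal_ne_top
  -- On a box the product mass is `∏ i, G (A i)`, so the joint moments determine the whole measure;
  -- finiteness of `ν` makes boxes sufficient.
  have hνQ : ν = Q := by
    refine ext_of_univ_pi _ _ fun A hA => ?_
    have hAm : MeasurableSet (univ.pi A) := .univ_pi hA
    rw [← lintegral_indicator_one hAm, ← lintegral_indicator_one hAm,
      hQ (measurable_one.indicator hAm)]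
    simp_rw [lintegral_indicator_one hAm, Measure.pi_pi]
    rw [hG.lintegral_prod_mul_exp hα hτ ι A hA f hf, Measure.smul_apply, Measure.finsetSum_apply,
      smul_eq_mul]
    congr 1
    refine Finset.sum_congr rfl fun s _ => ?_
    rw [Measure.map_apply (measurable_placeItems s) hAm]
    have : placeItems s ⁻¹' univ.pi A =
        univ.pi fun q : Quotient s => ⋂ i ∈ {i | Quotient.mk s i = q}, A i := by
      ext x
      simp only [placeItems, mem_preimage, mem_univ_pi, mem_iInter, mem_ofPred_eq]
      exact ⟨fun h q i hi => hi ▸ h i, fun h i => h _ i rfl⟩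
    rw [this, Measure.pi_pi]
    refine Finset.prod_congr rfl fun q _ => ?_
    rw [withDensity_apply _ (MeasurableSet.biInter (to_countable _) fun i _ => hA i)]
  rw [← hQ hF, ← hνQ, hν hF]

end IsGammaProcess

/-! ### Available time and its approximation by cells -/

section AvailableTime

variable {ι X : Type*} [Fintype ι]

open Classical in
/-- The total duration of the stages at which the item `x` is available: `x` is available at stage
`p` if no place preceding `p` carries it. -/
noncomputable def availableTime (prec : ι → ι → Prop) (z : ι → ℝ) (y : ι → X) (x : X) : ℝ :=
  ∑ p, z p * if ∀ j, prec j p → y j ≠ x then 1 else 0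

variable {prec : ι → ι → Prop} {z : ι → ℝ}

theorem availableTime_nonneg (hz : ∀ p, 0 ≤ z p) (y : ι → X) (x : X) :
    0 ≤ availableTime prec z y x :=
  Finset.sum_nonneg fun p _ => mul_nonneg (hz p) (by split_ifs <;> simp)

theorem availableTime_le (hz : ∀ p, 0 ≤ z p) (y : ι → X) (x : X) :
    availableTime prec z y x ≤ ∑ p, z p :=
  Finset.sum_le_sum fun p _ => mul_le_of_le_one_right (hz p) (by split_ifs <;> simp)

theorem availableTime_of_notMem {y : ι → X} {x : X} (hx : ∀ j, y j ≠ x) :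
    availableTime prec z y x = ∑ p, z p :=
  Finset.sum_congr rfl fun p _ => by rw [if_pos fun j _ => hx j, mul_one]

-- Only the set of places carrying `x` matters, so items can be replaced by their cells as soon as
-- the cells separate them from `x`.
open Classical in
theorem availableTime_congr {X' : Type*} {y : ι → X} {x : X} {y' : ι → X'} {x' : X'}
    (h : ∀ j, y j = x ↔ y' j = x') : availableTime prec z y x = availableTime prec z y' x' := by
  unfold availableTime
  refine Finset.sum_congr rfl fun p _ => congrArg (z p * ·) (if_congr ?_ rfl rfl)
  exact forall₂_congr fun j _ => not_congr (h j)

end AvailableTime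

section Cells

variable {ι X : Type*} [Fintype ι] {prec : ι → ι → Prop} {z : ι → ℝ}
  {c : (n : ℕ) → X → (Fin n → Bool)}

/-- There are finitely many places to separate from `x`, and separation persists under refinement;
so the values are eventually equal and no continuity is needed. -/
theorem eventually_availableTime_cells
    (hmono : ∀ x y n k, n ≤ k → c n x ≠ c n y → c k x ≠ c k y)
    (hsep : ∀ x y, x ≠ y → ∃ n, c n x ≠ c n y) (y : ι → X) (x : X) :
    ∀ᶠ n in atTop, availableTime prec z (fun i => c n (y i)) (c n x) =
      availableTime prec z y x := by
  have h : ∀ j, ∀ᶠ n in atTop, (c n (y j) = c n x ↔ y j = x) := fun j => by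
    by_cases hj : y j = x
    · exact Eventually.of_forall fun n => by simp [hj]
    · obtain ⟨k, hk⟩ := hsep _ _ hj
      filter_upwards [eventually_ge_atTop k] with n hn
      simp [hj, hmono _ _ k n hn hk]
  filter_upwards [eventually_all.2 h] with n hn using availableTime_congr hn

theorem tendsto_integral_availableTime_cells [MeasurableSpace X] (hc : ∀ n, Measurable (c n))
    (hmono : ∀ x y n k, n ≤ k → c n x ≠ c n y → c k x ≠ c k y)
    (hsep : ∀ x y, x ≠ y → ∃ n, c n x ≠ c n y) (hz : ∀ p, 0 ≤ z p)
    {μ : Measure X} [IsFiniteMeasure μ] {φ : ℝ → ℝ} {C : ℝ}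
    (hC : ∀ u, 0 ≤ u → u ≤ ∑ p, z p → |φ u| ≤ C) (y : ι → X) :
    Tendsto (fun n => ∫ x, φ (availableTime prec z (fun i => c n (y i)) (c n x)) ∂μ) atTop
      (𝓝 (∫ x, φ (availableTime prec z y x) ∂μ)) := by
  refine tendsto_integral_of_dominated_convergence (fun _ => C) (fun n => ?_) (integrable_const C)
    (fun n => ae_of_all _ fun x => ?_) (ae_of_all _ fun x => ?_)
  · exact ((measurable_of_countable fun k =>
      φ (availableTime prec z (fun i => c n (y i)) k)).comp (hc n)).aestronglyMeasurable
  · exact hC _ (availableTime_nonneg hz _ _) (availableTime_le hz _ _)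
  · refine tendsto_const_nhds.congr' ?_
    filter_upwards [eventually_availableTime_cells hmono hsep y x] with n hn
    rw [hn]

end Cells

/-- Splitting by the value of `d` freezes a tilt that depends on the places into finitely many
deterministic ones. -/
theorem lintegral_comp_of_finite {Y E : Type*} [MeasurableSpace Y] [MeasurableSpace E] [Fintype E]
    [MeasurableSingletonClass E] {μ : Measure Y} {d : Y → E} (hd : Measurable d)
    (F : E → Y → ℝ≥0∞) (hF : ∀ a, Measurable (F a)) :
    ∫⁻ y, F (d y) y ∂μ = ∑ a, ∫⁻ y, (d ⁻¹' {a}).indicator (F a) y ∂μ := by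
  classical
  rw [← lintegral_finsetSum _ fun a _ => (hF a).indicator (hd (measurableSet_singleton a))]
  refine lintegral_congr fun y => ?_
  rw [Finset.sum_eq_single (d y)]
  · simp
  · intro a _ ha
    exact indicator_of_notMem (by simpa using ha.symm) _
  · simp

namespace IsGammaProcess

variable {Ω X : Type*} [MeasurableSpace Ω] [MeasurableSpace X] {P : Measure Ω} {α τ : ℝ}
  {H : Measure X} {G : Ω → Measure X}

theorem aemeasurable_lintegral_cells (hG : IsGammaProcess α τ H G P)
    [∀ ω, IsFiniteMeasure (G ω)] {ι E : Type} [Fintype ι] [Fintype E] [MeasurableSpace E]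
    [MeasurableSingletonClass E] {d : (ι → X) → E} (hd : Measurable d) (f : E → SimpleFunc X ℝ)
    {F : (ι → X) → ℝ≥0∞} (hF : Measurable F) :
    AEMeasurable (fun ω => ∫⁻ y, F y * ENNReal.ofReal (Real.exp (-∫ x, f (d y) x ∂G ω))
      ∂(Measure.pi fun _ => G ω)) P := by
  have hpi : Measurable fun ω => Measure.pi fun _ : ι => G ω :=
    measurable_pi_of_isFiniteMeasure hG.measurable
  have h1 : ∀ ω, ∫⁻ y, F y * ENNReal.ofReal (Real.exp (-∫ x, f (d y) x ∂G ω))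
      ∂(Measure.pi fun _ => G ω) = ∑ a, (∫⁻ y, (d ⁻¹' {a}).indicator F y
        ∂(Measure.pi fun _ => G ω)) * ENNReal.ofReal (Real.exp (-∫ x, f a x ∂G ω)) := fun ω => by
    rw [lintegral_comp_of_finite hd (fun a y => F y * ENNReal.ofReal
      (Real.exp (-∫ x, f a x ∂G ω))) fun a => hF.mul_const _]
    refine Finset.sum_congr rfl fun a _ => ?_
    rw [← lintegral_mul_const _ (hF.indicator (hd (measurableSet_singleton a)))]
    simp_rw [← indicator_mul_const]
  simp_rw [h1]
  refine Finset.aemeasurable_fun_sum _ fun a _ => AEMeasurable.mul ?_ ?_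
  · exact ((Measure.measurable_lintegral (hF.indicator
      (hd (measurableSet_singleton a)))).comp hpi).aemeasurable
  · exact (hG.aemeasurable_integral_simpleFunc (f a)).neg.exp.ennreal_ofReal

open Classical in
/-- The moment formula for a tilting function that depends on the places through finitely many
cells. -/
theorem lintegral_cells (hG : IsGammaProcess α τ H G P) (hα : 0 < α) (hτ : 0 < τ)
    [IsFiniteMeasure H] [∀ ω, IsFiniteMeasure (G ω)] {ι E : Type} [Fintype ι] [Fintype E]
    [MeasurableSpace E] [MeasurableSingletonClass E] {d : (ι → X) → E} (hd : Measurable d)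
    (f : E → SimpleFunc X ℝ) (hf : ∀ a x, -τ < f a x) {F : (ι → X) → ℝ≥0∞} (hF : Measurable F) :
    ∫⁻ ω, ∫⁻ y, F y * ENNReal.ofReal (Real.exp (-∫ x, f (d y) x ∂G ω))
        ∂(Measure.pi fun _ => G ω) ∂P =
      ∑ s : Setoid ι, ∫⁻ x : Quotient s → X, F (placeItems s x) *
        (ENNReal.ofReal (Real.exp (-∫ u, gammaExponent α τ (f (d (placeItems s x)) u) ∂H)) *
          ∏ q, ENNReal.ofReal (gammaMoment α τ ({i | Quotient.mk s i = q} : Set ι).ncard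
            (f (d (placeItems s x)) (x q)))) ∂(Measure.pi fun _ => H) := by
  have hpi : Measurable fun ω => Measure.pi fun _ : ι => G ω :=
    measurable_pi_of_isFiniteMeasure hG.measurable
  have hfm : ∀ a, Measurable (f a) := fun a => (f a).measurable
  have hFa : ∀ a, Measurable ((d ⁻¹' {a}).indicator F) := fun a =>
    hF.indicator (hd (measurableSet_singleton a))
  have h1 : ∀ ω, ∫⁻ y, F y * ENNReal.ofReal (Real.exp (-∫ x, f (d y) x ∂G ω))
      ∂(Measure.pi fun _ => G ω) = ∑ a, ENNReal.ofReal (Real.exp (-∫ x, f a x ∂G ω)) *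
        ∫⁻ y, (d ⁻¹' {a}).indicator F y ∂(Measure.pi fun _ => G ω) := fun ω => by
    rw [lintegral_comp_of_finite hd (fun a y => F y * ENNReal.ofReal
      (Real.exp (-∫ x, f a x ∂G ω))) fun a => hF.mul_const _]
    refine Finset.sum_congr rfl fun a _ => ?_
    rw [← lintegral_const_mul _ (hFa a)]
    simp_rw [indicator_mul_const, mul_comm]
  simp_rw [h1]
  have hae : ∀ a, AEMeasurable (fun ω => ENNReal.ofReal (Real.exp (-∫ x, f a x ∂G ω)) *
      ∫⁻ y, (d ⁻¹' {a}).indicator F y ∂(Measure.pi fun _ => G ω)) P := fun a =>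
    (hG.aemeasurable_integral_simpleFunc (f a)).neg.exp.ennreal_ofReal.mul
      ((Measure.measurable_lintegral (hFa a)).comp hpi).aemeasurable
  rw [lintegral_finsetSum' _ fun a _ => hae a]
  simp_rw [hG.lintegral_exp_mul_lintegral_pi hα hτ ι (f _) (hf _) (hFa _), Finset.mul_sum]
  rw [Finset.sum_comm]
  refine Finset.sum_congr rfl fun s _ => ?_
  rw [lintegral_comp_of_finite (d := fun x => d (placeItems s x))
    (hd.comp (measurable_placeItems s)) (fun a x =>
    F (placeItems s x) * (ENNReal.ofReal (Real.exp (-∫ u, gammaExponent α τ (f a u) ∂H)) *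
      ∏ q, ENNReal.ofReal (gammaMoment α τ ({i | Quotient.mk s i = q} : Set ι).ncard
        (f a (x q))))) fun a => by fun_prop]
  refine Finset.sum_congr rfl fun a _ => ?_
  have hm := hFa a
  rw [← lintegral_const_mul _ (by fun_prop)]
  refine lintegral_congr fun x => ?_
  by_cases hx : d (placeItems s x) = a
  · rw [indicator_of_mem (by simpa using hx), indicator_of_mem (by simpa using hx)]
    ring
  · rw [indicator_of_notMem (by simpa using hx), indicator_of_notMem (by simpa using hx)]
    simp

end IsGammaProcess

theorem measurable_comp_of_countable {Y E E' R : Type*} [MeasurableSpace Y] [MeasurableSpace E]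
    [MeasurableSpace E'] [MeasurableSpace R] [Countable E] [Countable E']
    [MeasurableSingletonClass E] [MeasurableSingletonClass E'] {d : Y → E} {e : Y → E'}
    (hd : Measurable d) (he : Measurable e) (Φ : E → E' → R) :
    Measurable fun y => Φ (d y) (e y) :=
  (measurable_of_countable fun p : E × E' => Φ p.1 p.2).comp (hd.prodMk he)

namespace IsGammaProcess

variable {Ω X : Type*} [MeasurableSpace Ω] [MeasurableSpace X] {P : Measure Ω} {α τ : ℝ}
  {H : Measure X} {G : Ω → Measure X}

/-- This is the integrability part of the moment formula at tilt `0`; it supplies the dominating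
function when the cells are refined under the expectation. -/
theorem lintegral_pi_univ_lt_top (hG : IsGammaProcess α τ H G P) (hα : 0 < α) (hτ : 0 < τ)
    [IsFiniteMeasure H] [∀ ω, IsFiniteMeasure (G ω)] (ι : Type) [Fintype ι] :
    ∫⁻ ω, (Measure.pi fun _ : ι => G ω) univ ∂P ≠ ∞ := by
  classical
  have h := (hG.integral_prod_mul_exp hα hτ ι (fun _ => univ) (fun _ => .univ) 0
    (fun _ => by simpa using hτ)).1.2
  rw [hasFiniteIntegral_iff_ofReal (ae_of_all _ fun ω =>
    mul_nonneg (Finset.prod_nonneg fun i _ => ENNReal.toReal_nonneg) (Real.exp_pos _).le)] at h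
  convert h.ne using 2
  ext ω
  simp [Measure.pi_univ]

open Classical in
/-- The moment formula for a gamma process tilted by the available time of the items at the
places. -/
theorem lintegral_availableTime (hG : IsGammaProcess α τ H G P) (hα : 0 < α) (hτ : 0 < τ)
    [IsProbabilityMeasure H] [NullSingletonClass H] [MeasurableEq X]
    [∀ ω, IsFiniteMeasure (G ω)] {ι : Type} [Fintype ι] (prec : ι → ι → Prop) {z : ι → ℝ}
    (hz : ∀ p, 0 ≤ z p) {F : (ι → X) → ℝ≥0∞} (hF : Measurable F) (hF1 : ∀ y, F y ≤ 1) :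
    ∫⁻ ω, ∫⁻ y, F y * ENNReal.ofReal (Real.exp (-∫ x, availableTime prec z y x ∂G ω))
        ∂(Measure.pi fun _ => G ω) ∂P =
      ∑ s : Setoid ι, ∫⁻ x : Quotient s → X, F (placeItems s x) *
        (ENNReal.ofReal (Real.exp (-gammaExponent α τ (∑ p, z p))) *
          ∏ q, ENNReal.ofReal (gammaMoment α τ ({i | Quotient.mk s i = q} : Set ι).ncard
            (availableTime prec z (placeItems s x) (x q)))) ∂(Measure.pi fun _ => H) := by
  obtain ⟨c, hc, hmono, hsep⟩ := exists_separating_cells X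
  let d : (n : ℕ) → (ι → X) → (ι → Fin n → Bool) := fun n y i => c n (y i)
  have hd : ∀ n, Measurable (d n) := fun n =>
    measurable_pi_lambda _ fun i => (hc n).comp (measurable_pi_apply i)
  let f : (n : ℕ) → (ι → Fin n → Bool) → SimpleFunc X ℝ := fun n a =>
    (SimpleFunc.ofFinite (availableTime prec z a)).comp (c n) (hc n)
  have hfapp : ∀ n a x, f n a x = availableTime prec z a (c n x) := fun n a x => rfl
  have hf : ∀ n a x, -τ < f n a x := fun n a x =>
    (neg_lt_zero.2 hτ).trans_le (availableTime_nonneg hz _ _)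
  have hcells := fun n => hG.lintegral_cells hα hτ (hd n) (f n) (hf n) hF
  have hle1 : ∀ n ω y, F y * ENNReal.ofReal (Real.exp (-∫ x, f n (d n y) x ∂G ω)) ≤ 1 :=
    fun n ω y => by
      refine mul_le_one' (hF1 y) (ENNReal.ofReal_le_one.2 (Real.exp_le_one_iff.2 ?_))
      exact neg_nonpos.2 (integral_nonneg fun x => availableTime_nonneg hz _ _)
  have hinner : ∀ ω, Tendsto (fun n => ∫⁻ y, F y * ENNReal.ofReal
      (Real.exp (-∫ x, f n (d n y) x ∂G ω)) ∂(Measure.pi fun _ => G ω)) atTop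
      (𝓝 (∫⁻ y, F y * ENNReal.ofReal (Real.exp (-∫ x, availableTime prec z y x ∂G ω))
        ∂(Measure.pi fun _ => G ω))) := fun ω => by
    refine tendsto_lintegral_of_dominated_convergence (fun _ => 1) (fun n => ?_)
      (fun n => ae_of_all _ (hle1 n ω)) (by simp [measure_ne_top]) (ae_of_all _ fun y => ?_)
    · refine hF.mul ((measurable_of_countable fun a => ENNReal.ofReal
        (Real.exp (-∫ x, f n a x ∂G ω))).comp (hd n))
    · refine ENNReal.Tendsto.const_mul ?_ (Or.inr ((hF1 y).trans_lt ENNReal.one_lt_top).ne)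
      refine ENNReal.tendsto_ofReal ((Real.continuous_exp.tendsto _).comp (Tendsto.neg ?_))
      exact tendsto_integral_availableTime_cells hc hmono hsep hz (φ := fun u => u)
        (C := ∑ p, z p) (fun u h0 h1 => by rwa [abs_of_nonneg h0]) y
  have hleft : Tendsto (fun n => ∫⁻ ω, ∫⁻ y, F y * ENNReal.ofReal
      (Real.exp (-∫ x, f n (d n y) x ∂G ω)) ∂(Measure.pi fun _ => G ω) ∂P) atTop
      (𝓝 (∫⁻ ω, ∫⁻ y, F y * ENNReal.ofReal (Real.exp (-∫ x, availableTime prec z y x ∂G ω))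
        ∂(Measure.pi fun _ => G ω) ∂P)) := by
    refine tendsto_lintegral_of_dominated_convergence' (fun ω => (Measure.pi fun _ : ι => G ω) univ)
      (fun n => hG.aemeasurable_lintegral_cells (hd n) (f n) hF) (fun n => ae_of_all _ fun ω => ?_)
      (hG.lintegral_pi_univ_lt_top hα hτ ι) (ae_of_all _ hinner)
    exact (lintegral_mono (hle1 n ω)).trans (by simp)
  refine tendsto_nhds_unique hleft ?_
  simp_rw [hcells]
  refine tendsto_finsetSum _ fun s _ => ?_
  -- `κ(n, ·)` decreases on `[0, ∞)`, so its values at `0` dominate for every `n`.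
  let B : ℝ≥0∞ := ∏ q : Quotient s, ENNReal.ofReal
    (gammaMoment α τ ({i | Quotient.mk s i = q} : Set ι).ncard 0)
  have hB : B ≠ ∞ := ENNReal.prod_ne_top fun q _ => ENNReal.ofReal_ne_top
  refine tendsto_lintegral_of_dominated_convergence (fun _ => B) (fun n => ?_)
    (fun n => ae_of_all _ fun x => ?_) (by simp [hB]) (ae_of_all _ fun x => ?_)
  · have hds : Measurable fun x : Quotient s → X => d n (placeItems s x) :=
      (hd n).comp (measurable_placeItems s)
    refine (hF.comp (measurable_placeItems s)).mul (Measurable.mul ?_ ?_)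
    · exact (measurable_of_countable fun a => ENNReal.ofReal
        (Real.exp (-∫ u, gammaExponent α τ (f n a u) ∂H))).comp hds
    · refine Finset.measurable_fun_prod _ fun q _ => ?_
      exact measurable_comp_of_countable hds ((hc n).comp (measurable_pi_apply q)) fun a k =>
        ENNReal.ofReal (gammaMoment α τ ({i | Quotient.mk s i = q} : Set ι).ncard
          (availableTime prec z a k))
  · refine (mul_le_mul' (hF1 _) (mul_le_mul' (ENNReal.ofReal_le_one.2
      (Real.exp_le_one_iff.2 ?_)) (Finset.prod_le_prod' fun q _ =>
        ENNReal.ofReal_le_ofReal (gammaMoment_le hα hτ (one_le_ncard_block s q)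
          (availableTime_nonneg hz _ _))))).trans (by simp [B])
    exact neg_nonpos.2 (integral_nonneg fun u =>
      gammaExponent_nonneg hα hτ (availableTime_nonneg hz _ _))
  · refine ENNReal.Tendsto.const_mul ?_ (Or.inr ((hF1 _).trans_lt ENNReal.one_lt_top).ne)
    have hprod : ∀ᶠ n in atTop, ∏ q, ENNReal.ofReal
        (gammaMoment α τ ({i | Quotient.mk s i = q} : Set ι).ncard
          (f n (d n (placeItems s x)) (x q))) = ∏ q, ENNReal.ofReal
        (gammaMoment α τ ({i | Quotient.mk s i = q} : Set ι).ncard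
          (availableTime prec z (placeItems s x) (x q))) := by
      have h := eventually_all.2 fun q =>
        eventually_availableTime_cells (prec := prec) (z := z) hmono hsep (placeItems s x) (x q)
      filter_upwards [h] with n hn
      exact Finset.prod_congr rfl fun q _ => by rw [hfapp, ← hn q]
    -- The finitely many listed items form an `H`-null set, and any other item is available
    -- throughout. This is valid only in the limit, as cells may have positive mass.
    have hexp : ∫ u, gammaExponent α τ (availableTime prec z (placeItems s x) u) ∂H =
        gammaExponent α τ (∑ p, z p) := by
      have hae : ∀ᵐ u ∂H, availableTime prec z (placeItems s x) u = ∑ p, z p := by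
        have hfin : (range (placeItems s x)).Finite := finite_range _
        filter_upwards [hfin.countable.ae_notMem H] with u hu
        exact availableTime_of_notMem fun j hj => hu ⟨j, hj⟩
      rw [integral_congr_ae (hae.mono fun u hu => congrArg _ hu)]
      simp
    refine ENNReal.Tendsto.mul (b := ∏ q, ENNReal.ofReal
        (gammaMoment α τ ({i | Quotient.mk s i = q} : Set ι).ncard
          (availableTime prec z (placeItems s x) (x q)))) ?_
      (Or.inr (ENNReal.prod_ne_top fun q _ => ENNReal.ofReal_ne_top))
      (tendsto_const_nhds.congr' (hprod.mono fun n hn => hn.symm)) (Or.inr ENNReal.ofReal_ne_top)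
    refine ENNReal.tendsto_ofReal ((Real.continuous_exp.tendsto _).comp (Tendsto.neg ?_))
    rw [← hexp]
    exact tendsto_integral_availableTime_cells hc hmono hsep hz (φ := gammaExponent α τ)
      (C := gammaExponent α τ (∑ p, z p)) (fun u h0 h1 => by
        rw [abs_of_nonneg (gammaExponent_nonneg hα hτ h0)]
        exact gammaExponent_mono hα hτ h0 h1) _

end IsGammaProcess

/-! ### The conditional law of lists and durations given `G` -/

section RankingLaw

variable {X : Type*} [MeasurableSpace X] [MeasurableEq X] {m : ℕ}

theorem measurableSet_mem_remaining (i : Fin m) :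
    MeasurableSet {p : (Fin m → X) × X | p.2 ∈ remaining p.1 i} := by
  have : {p : (Fin m → X) × X | p.2 ∈ remaining p.1 i} =
      ⋂ j, ⋂ _ : j < i, {p : (Fin m → X) × X | p.1 j = p.2}ᶜ := by
    ext p; simp [remaining]
  rw [this]
  exact .iInter fun j => .iInter fun _ =>
    (measurableSet_eq_fun (by fun_prop) (by fun_prop)).compl

theorem measurableSet_self_mem_remaining (i : Fin m) :
    MeasurableSet {y : Fin m → X | y i ∈ remaining y i} :=
  (measurable_id.prodMk (measurable_pi_apply i)) (measurableSet_mem_remaining i)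

theorem measurable_measure_remaining (G : Measure X) [SFinite G] (i : Fin m) :
    Measurable fun y : Fin m → X => G (remaining y i) :=
  measurable_measure_prodMk_left (measurableSet_mem_remaining i)

theorem remaining_update {X : Type*} {m : ℕ} (y : Fin m → X) (i : Fin m) (x : X) :
    remaining (Function.update y i x) i = remaining y i := by
  ext u
  refine forall₂_congr fun j hj => ?_
  rw [Function.update_of_ne hj.ne]

open Classical in
/-- The joint density of the item and the duration of the `i`-th stage, given the earlier items. -/
noncomputable def stageDensity (G : Measure X) (y : Fin m → X) (z : Fin m → ℝ) (i : Fin m) :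
    ℝ≥0∞ :=
  if y i ∈ remaining y i ∧ 0 ≤ z i then
    ENNReal.ofReal (Real.exp (-((G (remaining y i)).toReal * z i))) else 0

theorem measurable_stageDensity (G : Measure X) [SFinite G] (i : Fin m) :
    Measurable fun p : (Fin m → X) × (Fin m → ℝ) => stageDensity G p.1 p.2 i := by
  have h1 : Measurable fun p : (Fin m → X) × (Fin m → ℝ) => G (remaining p.1 i) :=
    (measurable_measure_remaining G i).comp measurable_fst
  have h2 : Measurable fun p : (Fin m → X) × (Fin m → ℝ) => p.2 i := by fun_prop
  refine Measurable.ite ?_ (h1.ennreal_toReal.mul h2).neg.exp.ennreal_ofReal measurable_const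
  refine MeasurableSet.inter (measurable_fst (measurableSet_self_mem_remaining i)) ?_
  exact measurableSet_le measurable_const ((measurable_pi_apply i).comp measurable_snd)

theorem stageDensity_le_one {X : Type*} [MeasurableSpace X] {m : ℕ} (G : Measure X) (y : Fin m → X) (z : Fin m → ℝ) (i : Fin m) :
    stageDensity G y z i ≤ 1 := by
  rw [stageDensity]
  split_ifs with h
  · refine ENNReal.ofReal_le_one.2 (Real.exp_le_one_iff.2 ?_)
    have := mul_nonneg (ENNReal.toReal_nonneg (a := G (remaining y i))) h.2
    linarith
  · exact zero_le_one

/-- With the other coordinates frozen, `remaining y i` does not depend on `y i`; if it has mass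
zero, drawing `y i` from it is a null event. Without this the product of `G (remaining y i)` and its
inverse could not be cancelled. -/
theorem ae_measure_remaining_ne_zero (G : Measure X) [IsFiniteMeasure G] (i : Fin m) :
    ∀ᵐ y ∂(Measure.pi fun _ : Fin m => G), y i ∈ remaining y i → G (remaining y i) ≠ 0 := by
  classical
  have hN : MeasurableSet {y : Fin m → X | y i ∈ remaining y i ∧ G (remaining y i) = 0} :=
    (measurableSet_self_mem_remaining i).inter
      (measurable_measure_remaining G i (measurableSet_singleton 0))
  have h := lintegral_eq_of_lmarginal_eq (μ := fun _ : Fin m => G) {i}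
    (measurable_one.indicator hN) (measurable_const (a := (0 : ℝ≥0∞))) (by
      rw [lmarginal_singleton, lmarginal_singleton]
      ext y
      rw [lintegral_zero]
      by_cases hy : G (remaining y i) = 0
      · refine le_antisymm (le_trans ?_ hy.le) zero_le
        have hr : MeasurableSet (remaining y i) :=
          measurable_prodMk_left (measurableSet_mem_remaining i)
        rw [← lintegral_indicator_one hr]
        refine lintegral_mono fun x => ?_
        by_cases hx : Function.update y i x ∈
          {y : Fin m → X | y i ∈ remaining y i ∧ G (remaining y i) = 0}
        · have h1 := hx.1
          rw [remaining_update, Function.update_self] at h1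
          rw [indicator_of_mem hx, indicator_of_mem h1]
          exact le_rfl
        · rw [indicator_of_notMem hx]
          exact zero_le
      · refine (lintegral_congr fun x => ?_).trans lintegral_zero
        refine indicator_of_notMem (fun hx => hy ?_) _
        have := hx.2
        rwa [remaining_update] at this)
  rw [lintegral_indicator_one hN, lintegral_zero] at h
  rw [ae_iff]
  convert h using 2
  ext y; simp

open Classical in
/-- The joint law of a list and its durations has density `∏ exp (-G(remaining) z)`. -/
theorem rankingLaw_eq_withDensity (G : Measure X) [IsFiniteMeasure G] :
    rankingLaw m G = ((Measure.pi fun _ : Fin m => G).prod volume).withDensity fun p =>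
      ∏ i, stageDensity G p.1 p.2 i := by
  have h1 : Measurable fun y : Fin m → X =>
      ∏ i, if y i ∈ remaining y i then (G (remaining y i))⁻¹ else 0 :=
    Finset.measurable_fun_prod _ fun i _ => Measurable.ite (measurableSet_self_mem_remaining i)
      (measurable_measure_remaining G i).inv measurable_const
  have h2 : Measurable fun p : (Fin m → X) × (Fin m → ℝ) =>
      ∏ i, exponentialPDF (G (remaining p.1 i)).toReal (p.2 i) := by
    refine Finset.measurable_fun_prod _ fun i _ => ?_
    simp_rw [exponentialPDF_eq]
    have : Measurable fun p : (Fin m → X) × (Fin m → ℝ) => G (remaining p.1 i) :=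
      (measurable_measure_remaining G i).comp measurable_fst
    have hz : Measurable fun p : (Fin m → X) × (Fin m → ℝ) => p.2 i := by fun_prop
    exact (Measurable.ite (measurableSet_le measurable_const hz)
      (this.ennreal_toReal.mul (this.ennreal_toReal.mul hz).neg.exp)
      measurable_const).ennreal_ofReal
  have hm1 : Measurable fun p : (Fin m → X) × (Fin m → ℝ) =>
      ∏ i, if p.1 i ∈ remaining p.1 i then (G (remaining p.1 i))⁻¹ else 0 := h1.comp measurable_fst
  rw [rankingLaw, plackettLuce, prod_withDensity_left h1, ← withDensity_mul _ hm1 h2]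
  refine withDensity_congr_ae ?_
  have hae : ∀ᵐ p ∂((Measure.pi fun _ : Fin m => G).prod (volume : Measure (Fin m → ℝ))),
      ∀ i, p.1 i ∈ remaining p.1 i → G (remaining p.1 i) ≠ 0 :=
    Measure.quasiMeasurePreserving_fst.ae (ae_all_iff.2 fun i => ae_measure_remaining_ne_zero G i)
  filter_upwards [hae] with p hp
  rw [Pi.mul_apply, ← Finset.prod_mul_distrib]
  refine Finset.prod_congr rfl fun i _ => ?_
  rw [stageDensity, exponentialPDF_eq]
  by_cases hi : p.1 i ∈ remaining p.1 i
  · by_cases hz : 0 ≤ p.2 i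
    · rw [if_pos hi, if_pos hz, if_pos ⟨hi, hz⟩, ENNReal.ofReal_mul ENNReal.toReal_nonneg,
        ENNReal.ofReal_toReal (measure_ne_top G _), ← mul_assoc,
        ENNReal.inv_mul_cancel (hp i hi) (measure_ne_top G _), one_mul]
    · simp [hz]
  · simp [hi]

/-- A place precedes the later places of the same list. -/
def precedes {L m : ℕ} (j p : Fin L × Fin m) : Prop := j.1 = p.1 ∧ j.2 < p.2

theorem setOf_precedes_eq_remaining {X : Type*} {L m : ℕ} (y : Fin L × Fin m → X)
    (p : Fin L × Fin m) :
    {x | ∀ j, precedes j p → y j ≠ x} = remaining (fun i => y (p.1, i)) p.2 := by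
  ext x
  simp only [mem_ofPred_eq, remaining, precedes]
  exact ⟨fun h j hj => h (p.1, j) ⟨rfl, hj⟩, fun h j hj => by
    have := h j.2 hj.2; rwa [← hj.1] at this⟩

/-- Summing over stages and integrating over items commute; this makes the exponent linear in `G`,
as the moment formula requires. -/
theorem integral_availableTime_precedes {L : ℕ} (G : Measure X) [IsFiniteMeasure G]
    (z : Fin L × Fin m → ℝ) (y : Fin L × Fin m → X) :
    ∫ x, availableTime precedes z y x ∂G =
      ∑ p, (G (remaining (fun i => y (p.1, i)) p.2)).toReal * z p := by
  classical
  have hm : ∀ p : Fin L × Fin m, MeasurableSet (remaining (fun i => y (p.1, i)) p.2) := fun p =>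
    measurable_prodMk_left (measurableSet_mem_remaining p.2)
  have h : ∀ x, availableTime precedes z y x =
      ∑ p, (remaining (fun i => y (p.1, i)) p.2).indicator (fun _ => z p) x := fun x => by
    refine Finset.sum_congr rfl fun p _ => ?_
    rw [← setOf_precedes_eq_remaining, indicator_apply]
    simp only [mem_ofPred_eq, mul_ite, mul_one, mul_zero]
  simp_rw [h]
  rw [integral_finsetSum _ fun p _ => (integrable_const (z p)).indicator (hm p)]
  refine Finset.sum_congr rfl fun p _ => ?_
  rw [integral_indicator_const _ (hm p)]
  rfl

/-- The lists in `B` with no repetition within a list. -/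
def noRepeatSet {X : Type*} {L m : ℕ} (B : Set (Fin L → Fin m → X)) : Set (Fin L × Fin m → X) :=
  {y | Function.curry y ∈ B ∧ ∀ p : Fin L × Fin m, y p ∈ remaining (fun i => y (p.1, i)) p.2}

/-- The indicator of the lists in `B` with no repetition within a list. -/
noncomputable def noRepeat {X : Type*} {L m : ℕ} (B : Set (Fin L → Fin m → X)) :
    (Fin L × Fin m → X) → ℝ≥0∞ :=
  (noRepeatSet B).indicator 1

theorem measurable_noRepeat {L : ℕ} {B : Set (Fin L → Fin m → X)} (hB : MeasurableSet B) :
    Measurable (noRepeat B) := by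
  refine measurable_one.indicator (MeasurableSet.inter ?_ ?_)
  · exact (MeasurableEquiv.curry (Fin L) (Fin m) X).measurable hB
  · have : {y : Fin L × Fin m → X | ∀ p : Fin L × Fin m, y p ∈ remaining (fun i => y (p.1, i)) p.2} =
        ⋂ p : Fin L × Fin m, (fun (y : Fin L × Fin m → X) i => y (p.1, i)) ⁻¹'
          {y | y p.2 ∈ remaining y p.2} := by
      ext y; simp
    refine MeasurableSet.congr (MeasurableSet.iInter fun p => ?_) this.symm
    exact (measurable_pi_lambda _ fun i => measurable_pi_apply _) (measurableSet_self_mem_remaining p.2)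

theorem prod_stageDensity {L : ℕ} (G : Measure X) [IsFiniteMeasure G] (B : Set (Fin L → Fin m → X))
    (y : Fin L × Fin m → X) {z : Fin L → Fin m → ℝ} (hz : ∀ l i, 0 ≤ z l i) :
    B.indicator (fun y => ∏ l, ∏ i, stageDensity G (y l) (z l) i) (Function.curry y) =
      noRepeat B y *
        ENNReal.ofReal (Real.exp (-∫ x, availableTime precedes (Function.uncurry z) y x ∂G)) := by
  classical
  rw [integral_availableTime_precedes, noRepeat]
  by_cases hB : Function.curry y ∈ B
  · rw [indicator_of_mem hB]
    by_cases hr : ∀ p : Fin L × Fin m, y p ∈ remaining (fun i => y (p.1, i)) p.2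
    · rw [indicator_of_mem (s := noRepeatSet B) ⟨hB, hr⟩, Pi.one_apply, one_mul,
        ← Finset.sum_neg_distrib, Real.exp_sum,
        ENNReal.ofReal_prod_of_nonneg fun _ _ => (Real.exp_pos _).le, Fintype.prod_prod_type]
      refine Finset.prod_congr rfl fun l _ => Finset.prod_congr rfl fun i _ => ?_
      exact if_pos ⟨hr (l, i), hz l i⟩
    · rw [indicator_of_notMem (s := noRepeatSet B) fun h => hr h.2, zero_mul]
      push Not at hr
      obtain ⟨p, hp⟩ := hr
      refine Finset.prod_eq_zero (Finset.mem_univ p.1) (Finset.prod_eq_zero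
        (Finset.mem_univ p.2) ?_)
      exact if_neg fun h => hp h.1
  · rw [indicator_of_notMem hB, indicator_of_notMem (s := noRepeatSet B) fun h => hB h.1, zero_mul]

/-- The durations are kept in the outer integral so that the expectation over `G` can later be taken
at fixed `z`. -/
theorem pi_rankingLaw_prod {L : ℕ} (G : Measure X) [IsFiniteMeasure G]
    {B : Set (Fin L → Fin m → X)} (hB : MeasurableSet B) {C : Set (Fin L → Fin m → ℝ)}
    (hC : MeasurableSet C) :
    (Measure.pi fun _ : Fin L => rankingLaw m G)
        {q | (fun l => (q l).1) ∈ B ∧ (fun l => (q l).2) ∈ C} =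
      ∫⁻ z in C ∩ {z | ∀ l i, 0 ≤ z l i}, ∫⁻ y : Fin L × Fin m → X, noRepeat B y *
        ENNReal.ofReal (Real.exp (-∫ x, availableTime precedes (Function.uncurry z) y x ∂G))
          ∂(Measure.pi fun _ => G) := by
  have hd : Measurable fun p : (Fin m → X) × (Fin m → ℝ) => ∏ i, stageDensity G p.1 p.2 i :=
    Finset.measurable_fun_prod _ fun i _ => measurable_stageDensity G i
  have hsf : SigmaFinite (((Measure.pi fun _ : Fin m => G).prod
      (volume : Measure (Fin m → ℝ))).withDensity fun p => ∏ i, stageDensity G p.1 p.2 i) :=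
    SigmaFinite.withDensity_of_ne_top' fun p => ENNReal.prod_ne_top fun i _ =>
      ((stageDensity_le_one G p.1 p.2 i).trans_lt ENNReal.one_lt_top).ne
  have hmp := measurePreserving_arrowProdEquivProdArrow (Fin m → X) (Fin m → ℝ) (Fin L)
    (fun _ => Measure.pi fun _ : Fin m => G) (fun _ => volume)
  set e := MeasurableEquiv.arrowProdEquivProdArrow (Fin m → X) (Fin m → ℝ) (Fin L) with he
  have hset : {q : Fin L → (Fin m → X) × (Fin m → ℝ) |
      (fun l => (q l).1) ∈ B ∧ (fun l => (q l).2) ∈ C} = e ⁻¹' (B ×ˢ C) := rfl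
  let D : (Fin L → Fin m → X) × (Fin L → Fin m → ℝ) → ℝ≥0∞ := fun p =>
    ∏ l, ∏ i, stageDensity G (p.1 l) (p.2 l) i
  have hD : Measurable D := Finset.measurable_fun_prod _ fun l _ => by
    have hl : Measurable fun p : (Fin L → Fin m → X) × (Fin L → Fin m → ℝ) => (p.1 l, p.2 l) := by
      fun_prop
    exact hd.comp hl
  have hN : MeasurableSet {z : Fin L → Fin m → ℝ | ∀ l i, 0 ≤ z l i} := by
    simp only [ofPred_forall]
    exact .iInter fun l => .iInter fun i => measurableSet_le measurable_const (by fun_prop)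
  simp_rw [rankingLaw_eq_withDensity]
  rw [pi_withDensity (fun _ : Fin L => fun p : (Fin m → X) × (Fin m → ℝ) =>
    ∏ i, stageDensity G p.1 p.2 i) fun _ => hd, hset,
    withDensity_apply _ (e.measurable (hB.prod hC))]
  have h1 : ∫⁻ q in e ⁻¹' (B ×ˢ C), ∏ l, ∏ i, stageDensity G (q l).1 (q l).2 i
      ∂(Measure.pi fun _ : Fin L => (Measure.pi fun _ : Fin m => G).prod volume) =
      ∫⁻ p in B ×ˢ C, D p ∂((Measure.pi fun _ : Fin L => Measure.pi fun _ : Fin m => G).prod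
        (Measure.pi fun _ : Fin L => (volume : Measure (Fin m → ℝ)))) :=
    hmp.setLIntegral_comp_preimage_emb e.measurableEmbedding D (B ×ˢ C)
  rw [h1, ← Measure.prod_restrict, lintegral_prod_symm _ hD.aemeasurable, ← volume_pi,
    inter_comm, ← Measure.restrict_restrict hN, ← lintegral_indicator hN]
  set N := {z : Fin L → Fin m → ℝ | ∀ l i, 0 ≤ z l i}
  refine lintegral_congr fun z => ?_
  by_cases hz : ∀ l i, 0 ≤ z l i
  · rw [indicator_of_mem (show z ∈ N from hz), ← lintegral_indicator hB, ← pi_map_curry,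
      lintegral_map_equiv]
    exact lintegral_congr fun y => prod_stageDensity G B y hz
  · rw [indicator_of_notMem (show z ∉ N from hz)]
    refine (lintegral_congr fun y => ?_).trans lintegral_zero
    push Not at hz
    obtain ⟨l, i, hi⟩ := hz
    refine Finset.prod_eq_zero (Finset.mem_univ l) (Finset.prod_eq_zero (Finset.mem_univ i) ?_)
    exact if_neg fun h => (h.2.trans_lt hi).false

end RankingLaw

/-! ### The marginal density on each tie pattern -/

section Density

variable {X : Type*} {L m : ℕ}

theorem ncard_block_eq_card {ι : Type*} [Fintype ι] (p : ι → Prop) [DecidablePred p] :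
    ({i | p i} : Set ι).ncard = (Finset.univ.filter p).card := by
  rw [← ncard_coe_finset]
  congr 1
  ext; simp

theorem sum_notYetListed (y : Fin L × Fin m → X) (z : Fin L → Fin m → ℝ) (x : X) :
    ∑ l, ∑ i, notYetListed (Function.curry y) x l i * z l i =
      availableTime precedes (Function.uncurry z) y x := by
  classical
  rw [availableTime, Fintype.sum_prod_type]
  refine Finset.sum_congr rfl fun l _ => Finset.sum_congr rfl fun i _ => ?_
  have h : (∃ j, j < i ∧ Function.curry y l j = x) ↔ ¬∀ j, precedes j (l, i) → y j ≠ x := by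
    push Not
    constructor
    · rintro ⟨j, hj, hx⟩
      exact ⟨(l, j), ⟨rfl, hj⟩, hx⟩
    · rintro ⟨⟨l', j⟩, ⟨h1, h2⟩, hx⟩
      obtain rfl : l' = l := h1
      exact ⟨j, h2, hx⟩
  rw [notYetListed, mul_comm]
  change z l i * _ = z l i * _
  congr 1
  by_cases hc : ∀ j, precedes j (l, i) → y j ≠ x
  · rw [if_pos hc, if_neg (h.not.2 (not_not.2 hc))]
  · rw [if_neg hc, if_pos (h.2 hc)]

theorem forall_injective_iff_mem_noRepeatSet (y : Fin L × Fin m → X) :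
    (∀ l, Function.Injective (Function.curry y l)) ↔ y ∈ noRepeatSet univ := by
  constructor
  · exact fun h => ⟨mem_univ _, fun p j hj e => hj.ne (h p.1 e)⟩
  · rintro ⟨-, h⟩ l i j hij
    rcases lt_trichotomy i j with hlt | rfl | hlt
    · exact (h (l, j) i hlt hij).elim
    · rfl
    · exact (h (l, i) j hlt hij.symm).elim

theorem uniqueItems_placeItems (s : Setoid (Fin L × Fin m)) [Fintype (Quotient s)]
    [DecidableEq X] (x : Quotient s → X) :
    uniqueItems (Function.curry (placeItems s x)) = Finset.univ.image x := by
  ext u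
  simp only [uniqueItems, Finset.mem_image, Finset.mem_univ, true_and]
  constructor
  · rintro ⟨p, hp⟩
    exact ⟨Quotient.mk s p, hp⟩
  · rintro ⟨q, hq⟩
    induction q using Quotient.inductionOn with | _ p => exact ⟨p, hq⟩

theorem occurrences_placeItems (s : Setoid (Fin L × Fin m)) {x : Quotient s → X}
    (hx : Function.Injective x) (q : Quotient s) :
    occurrences (Function.curry (placeItems s x)) (x q) =
      ({i | Quotient.mk s i = q} : Set (Fin L × Fin m)).ncard := by
  classical
  rw [ncard_block_eq_card, occurrences]
  congr 1
  ext p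
  simp only [Finset.mem_filter, Finset.mem_univ, true_and]
  exact hx.eq_iff (a := Quotient.mk s p)

open Classical in
/-- The joint density of the items of the blocks of a tie pattern and of the durations, relative to
the base distribution of the items. -/
noncomputable def patternDensity (α τ : ℝ) (s : Setoid (Fin L × Fin m)) (x : Quotient s → X)
    (z : Fin L → Fin m → ℝ) : ℝ≥0∞ :=
  ENNReal.ofReal (Real.exp (-gammaExponent α τ (∑ p, Function.uncurry z p))) *
    ∏ q, ENNReal.ofReal (gammaMoment α τ ({i | Quotient.mk s i = q} : Set (Fin L × Fin m)).ncard
      (availableTime precedes (Function.uncurry z) (placeItems s x) (x q)))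

-- Injectivity of `x` makes blocks correspond to unique items, and block sizes to numbers of
-- occurrences.
open Classical in
theorem marginalDensity_placeItems {α τ : ℝ} (hα : 0 < α) (hτ : 0 < τ) (h : X → ℝ≥0∞)
    (s : Setoid (Fin L × Fin m)) {x : Quotient s → X} (hx : Function.Injective x)
    {z : Fin L → Fin m → ℝ} (hz : ∀ l i, 0 ≤ z l i) :
    marginalDensity (levyIntensity α τ) h (Function.curry (placeItems s x), z) =
      (∏ q, h (x q)) * (noRepeat univ (placeItems s x) * patternDensity α τ s x z) := by
  have hz' : ∀ p, 0 ≤ Function.uncurry z p := fun p => hz p.1 p.2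
  rw [marginalDensity, noRepeat]
  by_cases hr : placeItems s x ∈ noRepeatSet univ
  · rw [if_pos ⟨(forall_injective_iff_mem_noRepeatSet _).2 hr, hz⟩, indicator_of_mem hr,
      Pi.one_apply, one_mul, patternDensity]
    simp only
    rw [uniqueItems_placeItems, Finset.prod_image hx.injOn, Finset.prod_mul_distrib]
    have hsum : ∑ l, ∑ i, z l i = ∑ p, Function.uncurry z p := 
      (Fintype.sum_prod_type (Function.uncurry z)).symm
    rw [hsum, laplaceExponent_levyIntensity hα hτ (Finset.sum_nonneg fun p _ => hz' p)]
    have hmom : ∀ q, tiltedMoment (levyIntensity α τ)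
        (occurrences (Function.curry (placeItems s x)) (x q))
        (∑ l, ∑ i, notYetListed (Function.curry (placeItems s x)) (x q) l i * z l i) =
        gammaMoment α τ ({i | Quotient.mk s i = q} : Set (Fin L × Fin m)).ncard
          (availableTime precedes (Function.uncurry z) (placeItems s x) (x q)) := fun q => by
      rw [occurrences_placeItems s hx, sum_notYetListed]
      exact tiltedMoment_levyIntensity hτ (one_le_ncard_block s q) (availableTime_nonneg hz' _ _)
    simp_rw [hmom]
    ring
  · rw [if_neg fun hc => hr ((forall_injective_iff_mem_noRepeatSet _).1 hc.1),
      indicator_of_notMem hr, zero_mul, mul_zero]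

theorem marginalDensity_eq_zero (lam : ℝ → ℝ) (h : X → ℝ≥0∞) {Y : Fin L → Fin m → X}
    (z : Fin L → Fin m → ℝ) {x : X} (hx : x ∈ uniqueItems Y) (hhx : h x = 0) :
    marginalDensity lam h (Y, z) = 0 := by
  rw [marginalDensity]
  split_ifs
  · rw [Finset.prod_eq_zero hx (by rw [hhx, zero_mul]), mul_zero]
  · rfl

variable [MeasurableSpace X] [MeasurableEq X]

theorem measurable_availableTime {Y ι : Type*} [MeasurableSpace Y] [Fintype ι]
    (prec : ι → ι → Prop) {z : Y → ι → ℝ} {y : Y → ι → X} {x : Y → X} (hz : Measurable z)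
    (hy : Measurable y) (hx : Measurable x) :
    Measurable fun t => availableTime prec (z t) (y t) (x t) := by
  classical
  unfold availableTime
  refine Finset.measurable_fun_sum _ fun p _ => Measurable.mul (by fun_prop) ?_
  refine Measurable.ite ?_ measurable_const measurable_const
  simp only [ofPred_forall]
  exact .iInter fun j => .iInter fun _ =>
    (measurableSet_eq_fun ((measurable_pi_apply j).comp hy) hx).compl

theorem measurableSet_ker_eq {ι : Type*} [Finite ι] (s : Setoid ι) :
    MeasurableSet {y : ι → X | Setoid.ker y = s} := by
  have : {y : ι → X | Setoid.ker y = s} =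
      ⋂ i, ⋂ j, {y : ι → X | y i = y j ↔ s i j} := by
    ext y
    simp only [mem_ofPred_eq, mem_iInter, Setoid.ext_iff, Setoid.ker_def]
  rw [this]
  refine .iInter fun i => .iInter fun j => ?_
  have hm : MeasurableSet {y : ι → X | y i = y j} :=
    measurableSet_eq_fun (measurable_pi_apply i) (measurable_pi_apply j)
  by_cases hs : s i j
  · exact hm.congr (by ext y; simp [hs])
  · exact hm.compl.congr (by ext y; simp [hs])

theorem measurable_patternDensity {T : Type*} [MeasurableSpace T] (α τ : ℝ)
    (s : Setoid (Fin L × Fin m)) {x : T → Quotient s → X} {z : T → Fin L → Fin m → ℝ}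
    (hx : Measurable x) (hz : Measurable z) :
    Measurable fun t => patternDensity α τ s (x t) (z t) := by
  have hz' : Measurable fun t => Function.uncurry (z t) :=
    measurable_pi_lambda _ fun p => by
      exact (measurable_pi_apply p.2).comp ((measurable_pi_apply p.1).comp hz)
  unfold patternDensity
  refine Measurable.mul ?_ (Finset.measurable_fun_prod _ fun q _ => ?_)
  · have : Measurable fun t => ∑ p, Function.uncurry (z t) p :=
      Finset.measurable_fun_sum _ fun p _ => (measurable_pi_apply p).comp hz'
    exact ((measurable_gammaExponent α τ).comp this).neg.exp.ennreal_ofReal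
  · exact ((measurable_gammaMoment α τ _).comp (measurable_availableTime precedes hz'
      ((measurable_placeItems s).comp hx) ((measurable_pi_apply q).comp hx))).ennreal_ofReal

theorem measurableSet_forall_nonneg :
    MeasurableSet {z : Fin L → Fin m → ℝ | ∀ l i, 0 ≤ z l i} := by
  simp only [ofPred_forall]
  exact .iInter fun l => .iInter fun i => measurableSet_le measurable_const (by fun_prop)

/-- The unique items vary with the data, but on each of the finitely many tie patterns the density
is an explicit measurable function of one representative item per block. -/
theorem measurable_marginalDensity {α τ : ℝ} (hα : 0 < α) (hτ : 0 < τ) {h : X → ℝ≥0∞}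
    (hh : Measurable h) :
    Measurable fun p : (Fin L → Fin m → X) × (Fin L → Fin m → ℝ) =>
      marginalDensity (levyIntensity α τ) h p := by
  classical
  have hu : Measurable fun p : (Fin L → Fin m → X) × (Fin L → Fin m → ℝ) =>
      Function.uncurry p.1 := (MeasurableEquiv.curry (Fin L) (Fin m) X).symm.measurable.comp
    measurable_fst
  let S : Setoid (Fin L × Fin m) → Set ((Fin L → Fin m → X) × (Fin L → Fin m → ℝ)) := fun s =>
    {p | Setoid.ker (Function.uncurry p.1) = s ∧ ∀ l i, 0 ≤ p.2 l i}
  have hS : ∀ s, MeasurableSet (S s) := fun s =>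
    (hu (measurableSet_ker_eq s)).inter (measurable_snd measurableSet_forall_nonneg)
  let x : (s : Setoid (Fin L × Fin m)) → (Fin L → Fin m → X) × (Fin L → Fin m → ℝ) →
    Quotient s → X := fun s p q => Function.uncurry p.1 q.out
  have hx : ∀ s, Measurable (x s) := fun s =>
    measurable_pi_lambda _ fun q => (measurable_pi_apply q.out).comp hu
  have heq : (fun p : (Fin L → Fin m → X) × (Fin L → Fin m → ℝ) =>
      marginalDensity (levyIntensity α τ) h p) = fun p => ∑ s, (S s).indicator (fun p =>
        (∏ q, h (x s p q)) * (noRepeat univ (placeItems s (x s p)) *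
          patternDensity α τ s (x s p) p.2)) p := by
    ext p
    by_cases hz : ∀ l i, 0 ≤ p.2 l i
    · set s := Setoid.ker (Function.uncurry p.1) with hs
      have hpl : placeItems s (x s p) = Function.uncurry p.1 := by
        ext i
        exact (Setoid.ker_def (f := Function.uncurry p.1)).1 (Quotient.exact (Quotient.out_eq _))
      have hinj : Function.Injective (x s p) := fun q q' hq => by
        rw [← Quotient.out_eq q, ← Quotient.out_eq q']
        exact Quotient.sound hq
      rw [Finset.sum_eq_single s]
      · rw [indicator_of_mem (show p ∈ S s from ⟨rfl, hz⟩),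
          ← marginalDensity_placeItems hα hτ h s hinj hz, hpl]
        rfl
      · intro t _ ht
        exact indicator_of_notMem (fun hp => ht hp.1.symm) _
      · simp
    · rw [Finset.sum_eq_zero fun s _ => indicator_of_notMem (fun hp => hz hp.2) _]
      rw [marginalDensity, if_neg fun hp => hz hp.2]
  rw [heq]
  refine Finset.measurable_fun_sum _ fun s _ => Measurable.indicator ?_ (hS s)
  refine Measurable.mul ?_ (Measurable.mul ?_ ?_)
  · exact Finset.measurable_fun_prod _ fun q _ => hh.comp ((measurable_pi_apply q).comp (hx s))
  · exact (measurable_noRepeat .univ).comp ((measurable_placeItems s).comp (hx s))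
  · exact measurable_patternDensity α τ s (hx s) measurable_snd

/-- With all coordinates but `q` frozen, a coincidence with `x q'` confines `x q` to a singleton,
which is null for `H`. -/
theorem ae_injective_pi {κ : Type*} [Fintype κ] (H : Measure X) [SigmaFinite H]
    [NullSingletonClass H] : ∀ᵐ x ∂(Measure.pi fun _ : κ => H), Function.Injective x := by
  classical
  have h : ∀ q q' : κ, q ≠ q' → ∀ᵐ x ∂(Measure.pi fun _ : κ => H), x q ≠ x q' := fun q q' hq => by
    have hN : MeasurableSet {x : κ → X | x q = x q'} :=
      measurableSet_eq_fun (measurable_pi_apply q) (measurable_pi_apply q')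
    have h := lintegral_eq_of_lmarginal_eq (μ := fun _ : κ => H) {q}
      (measurable_one.indicator hN) (measurable_const (a := (0 : ℝ≥0∞))) (by
        rw [lmarginal_singleton, lmarginal_singleton]
        ext x
        rw [lintegral_zero]
        have : ∀ u, {x : κ → X | x q = x q'}.indicator (1 : (κ → X) → ℝ≥0∞)
            (Function.update x q u) = ({x q'} : Set X).indicator 1 u := fun u => by
          simp only [indicator_apply, mem_ofPred_eq, Function.update_self,
            Function.update_of_ne hq.symm, mem_singleton_iff]
          rfl
        simp_rw [this]
        rw [lintegral_indicator_one (measurableSet_singleton _), measure_singleton])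
    rw [lintegral_indicator_one hN, lintegral_zero] at h
    rw [ae_iff]
    simpa using h
  have h' := ae_all_iff.2 fun q => ae_all_iff.2 fun q' => ae_all_iff.2 (h q q')
  filter_upwards [h'] with x hx q q' hqq
  by_contra hne
  exact hx q q' hne hqq

end Density

/-! ### Integration against the reference measure -/

section ReferenceMeasure

variable {X : Type*} [MeasurableSpace X] {L m : ℕ}

instance sFinite_tiedMeasure (μ : Measure X) [SigmaFinite μ] : SFinite (tiedMeasure L m μ) := by
  unfold tiedMeasure; infer_instance

open Classical in
theorem lintegral_tiedMeasure (μ : Measure X) {F : (Fin L → Fin m → X) → ℝ≥0∞}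
    (hF : Measurable F) :
    ∫⁻ y, F y ∂tiedMeasure L m μ = ∑ s : Setoid (Fin L × Fin m),
      ∫⁻ x : Quotient s → X, F (Function.curry (placeItems s x)) ∂(Measure.pi fun _ => μ) := by
  rw [tiedMeasure, lintegral_sum_measure, tsum_fintype]
  refine Finset.sum_congr rfl fun s _ => ?_
  rw [lintegral_map hF (by fun_prop)]
  rfl

variable [MeasurableEq X]

open Classical in
/-- Integration of the marginal density of the lists against the reference measure, for given
durations. -/
theorem setLIntegral_marginalDensity {α τ : ℝ} (hα : 0 < α) (hτ : 0 < τ) (μ : Measure X)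
    [SigmaFinite μ] {h : X → ℝ≥0∞} (hh : Measurable h) (H : Measure X) [IsProbabilityMeasure H]
    [NullSingletonClass H] (hH : H = μ.withDensity h) {B : Set (Fin L → Fin m → X)}
    (hB : MeasurableSet B) {z : Fin L → Fin m → ℝ} (hz : ∀ l i, 0 ≤ z l i) :
    ∫⁻ y in B, marginalDensity (levyIntensity α τ) h (y, z) ∂tiedMeasure L m μ =
      ∑ s : Setoid (Fin L × Fin m), ∫⁻ x : Quotient s → X,
        noRepeat B (placeItems s x) * patternDensity α τ s x z ∂(Measure.pi fun _ => H) := by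
  have hm : Measurable fun y => marginalDensity (L := L) (m := m) (levyIntensity α τ) h (y, z) :=
    (measurable_marginalDensity hα hτ hh).comp (measurable_id.prodMk measurable_const)
  rw [← lintegral_indicator hB, lintegral_tiedMeasure μ (hm.indicator hB)]
  refine Finset.sum_congr rfl fun s _ => ?_
  have hp : Measurable fun x : Quotient s → X => ∏ q, h (x q) := by fun_prop
  have hsf : SigmaFinite (μ.withDensity h) := hH ▸ inferInstance
  have hpi : (Measure.pi fun _ : Quotient s => H) =
      (Measure.pi fun _ => μ).withDensity fun x => ∏ q, h (x q) := by
    rw [← pi_withDensity (fun _ => h) fun _ => hh, hH]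
  have hd : Measurable fun x : Quotient s → X =>
      noRepeat B (placeItems s x) * patternDensity α τ s x z :=
    ((measurable_noRepeat hB).comp (measurable_placeItems s)).mul
      (measurable_patternDensity α τ s measurable_id measurable_const)
  have hinj := ae_injective_pi (κ := Quotient s) H
  rw [hpi, ae_withDensity_iff hp] at hinj
  rw [hpi, lintegral_withDensity_eq_lintegral_mul _ hp hd]
  refine lintegral_congr_ae ?_
  filter_upwards [hinj] with x hx
  rw [Pi.mul_apply]
  -- `μ` may have atoms, so injectivity is available only where `∏ h ≠ 0`; elsewhere both sides
  -- vanish.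
  by_cases h0 : ∏ q, h (x q) = 0
  · obtain ⟨q, -, hq⟩ := Finset.prod_eq_zero_iff.1 h0
    rw [h0, zero_mul]
    refine indicator_apply_eq_zero.2 fun _ => marginalDensity_eq_zero _ _ _ (x := x q) ?_ hq
    rw [uniqueItems_placeItems]
    exact Finset.mem_image_of_mem _ (Finset.mem_univ q)
  · by_cases hxB : Function.curry (placeItems s x) ∈ B
    · rw [indicator_of_mem hxB, marginalDensity_placeItems hα hτ h s (hx h0) hz]
      have : noRepeat B (placeItems s x) = noRepeat univ (placeItems s x) := by
        simp [noRepeat, noRepeatSet, indicator_apply, hxB]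
      rw [this]
    · have : noRepeat B (placeItems s x) = 0 := indicator_of_notMem (fun hc => hxB hc.1) _
      rw [indicator_of_notMem hxB, this, zero_mul, mul_zero]

end ReferenceMeasure

/-! ### Averaging over `G` and conclusion -/

/-- The tilted mass of the lists is jointly measurable in the random measure and the durations. -/
theorem measurable_lintegral_noRepeat {Ω X : Type*} [MeasurableSpace Ω] [MeasurableSpace X]
    [MeasurableEq X] {L m : ℕ} {G : Ω → Measure X} (hG : Measurable G)
    [∀ ω, IsFiniteMeasure (G ω)] {B : Set (Fin L → Fin m → X)} (hB : MeasurableSet B) :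
    Measurable fun p : Ω × (Fin L → Fin m → ℝ) =>
      ∫⁻ y : Fin L × Fin m → X, noRepeat B y * ENNReal.ofReal
        (Real.exp (-∫ x, availableTime precedes (Function.uncurry p.2) y x ∂G p.1))
          ∂(Measure.pi fun _ => G p.1) := by
  -- Viewing `G` and its powers as s-finite kernels yields joint measurability, which Tonelli's
  -- theorem for `P` and the durations requires.
  let κ : Kernel Ω X := ⟨G, hG⟩
  let η : Kernel Ω (Fin L × Fin m → X) :=
    ⟨fun ω => Measure.pi fun _ => G ω, measurable_pi_of_isFiniteMeasure hG⟩
  have hκf : ∀ ω, IsFiniteMeasure (κ ω) := fun ω => inferInstanceAs (IsFiniteMeasure (G ω))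
  have hηf : ∀ ω, IsFiniteMeasure (η ω) := fun ω =>
    inferInstanceAs (IsFiniteMeasure (Measure.pi fun _ : Fin L × Fin m => G ω))
  have hκ : IsSFiniteKernel κ := isSFiniteKernel_of_isFiniteMeasure κ
  have hη : IsSFiniteKernel η := isSFiniteKernel_of_isFiniteMeasure η
  have hr : ∀ p : Fin L × Fin m,
      Measurable fun q : (Ω × (Fin L → Fin m → ℝ)) × (Fin L × Fin m → X) =>
        G q.1.1 (remaining (fun i => q.2 (p.1, i)) p.2) := fun p => by
    have ht : MeasurableSet {r : ((Ω × (Fin L → Fin m → ℝ)) × (Fin L × Fin m → X)) × X |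
        r.2 ∈ remaining (fun i => r.1.2 (p.1, i)) p.2} := by
      have : Measurable fun r : ((Ω × (Fin L → Fin m → ℝ)) × (Fin L × Fin m → X)) × X =>
          ((fun i => r.1.2 (p.1, i) : Fin m → X), r.2) := by fun_prop
      exact this (measurableSet_mem_remaining p.2)
    exact Kernel.measurable_kernel_prodMk_left
      (κ := κ.comap (fun q : (Ω × (Fin L → Fin m → ℝ)) × (Fin L × Fin m → X) => q.1.1)
        (by fun_prop)) ht
  have hm : Measurable fun q : (Ω × (Fin L → Fin m → ℝ)) × (Fin L × Fin m → X) =>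
      noRepeat B q.2 * ENNReal.ofReal
        (Real.exp (-∫ x, availableTime precedes (Function.uncurry q.1.2) q.2 x ∂G q.1.1)) := by
    simp_rw [integral_availableTime_precedes]
    refine ((measurable_noRepeat hB).comp measurable_snd).mul
      (Finset.measurable_fun_sum _ fun p _ => (hr p).ennreal_toReal.mul ?_).neg.exp.ennreal_ofReal
    exact (measurable_pi_apply p.2).comp
      ((measurable_pi_apply p.1).comp (measurable_snd.comp measurable_fst))
  exact Measurable.lintegral_kernel_prod_right' (κ := η.comap Prod.fst measurable_fst) hm

open Classical in
/-- A gamma process may be modified on a null set to take values in the finite measures. -/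
theorem IsGammaProcess.exists_isFiniteMeasure {Ω X : Type*} [MeasurableSpace Ω]
    [MeasurableSpace X] {P : Measure Ω} {α τ : ℝ} {H : Measure X} {G : Ω → Measure X}
    (hG : IsGammaProcess α τ H G P) :
    ∃ G' : Ω → Measure X, IsGammaProcess α τ H G' P ∧ (∀ ω, IsFiniteMeasure (G' ω)) ∧
      G' =ᵐ[P] G := by
  let S : Set Ω := {ω | G ω univ < ∞}
  have hS : MeasurableSet S := measurableSet_lt (hG.measurable_apply .univ) measurable_const
  let G' : Ω → Measure X := fun ω => if G ω univ < ∞ then G ω else 0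
  have hae : G' =ᵐ[P] G := by
    filter_upwards [hG.ae_isFiniteMeasure] with ω hω using if_pos (measure_lt_top _ _)
  refine ⟨G', ⟨Measurable.ite hS hG.measurable measurable_const, fun A hA => ?_,
    fun n A hA hd => ?_⟩, fun ω => ?_, hae⟩
  · rw [← hG.marginal A hA]
    exact Measure.map_congr (hae.mono fun ω hω => by simp only [hω])
  · exact (hG.indep n A hA hd).congr fun k => hae.mono fun ω hω => by simp only [hω]
  · change IsFiniteMeasure (if G ω univ < ∞ then G ω else 0)
    split_ifs with h
    · exact ⟨h⟩
    · infer_instance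

theorem map_eq_withDensity_marginalDensity {Ω X : Type*} [MeasurableSpace Ω] [MeasurableSpace X]
    [MeasurableEq X] (P : Measure Ω) [IsProbabilityMeasure P] (α τ : ℝ) (hα : 0 < α) (hτ : 0 < τ)
    (μ : Measure X) [SigmaFinite μ] (h : X → ENNReal) (hh : Measurable h)
    (H : Measure X) [IsProbabilityMeasure H] [NullSingletonClass H] (hH : H = μ.withDensity h)
    (L m : ℕ) (G : Ω → Measure X) (hG : IsGammaProcess α τ H G P)
    (Y : Ω → Fin L → Fin m → X) (Z : Ω → Fin L → Fin m → ℝ)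
    (hYZ : IsPlackettLuceSample G Y Z P) :
    P.map (fun ω => (Y ω, Z ω)) =
      ((tiedMeasure L m μ).prod volume).withDensity
        (marginalDensity (levyIntensity α τ) h) := by
  classical
  have hmeas : Measurable fun ω => (Y ω, Z ω) := hYZ.measurable_Y.prodMk hYZ.measurable_Z
  -- The moment formulas ask for finite measures at every `ω`, while `G` is finite only almost
  -- surely.
  obtain ⟨G', hG', hfin, hae⟩ := hG.exists_isFiniteMeasure
  set N := {z : Fin L → Fin m → ℝ | ∀ l i, 0 ≤ z l i} with hN
  have hNm : MeasurableSet N := measurableSet_forall_nonneg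
  have hrect : ∀ B : Set (Fin L → Fin m → X), MeasurableSet B →
      ∀ C : Set (Fin L → Fin m → ℝ), MeasurableSet C →
      P.map (fun ω => (Y ω, Z ω)) (B ×ˢ C) =
        ((tiedMeasure L m μ).prod volume).withDensity
          (marginalDensity (levyIntensity α τ) h) (B ×ˢ C) := by
    intro B hB C hC
    have hmd := measurable_marginalDensity (L := L) (m := m) hα hτ hh
    have hset : MeasurableSet {q : Fin L → (Fin m → X) × (Fin m → ℝ) |
        (fun l => (q l).1) ∈ B ∧ (fun l => (q l).2) ∈ C} := by
      have h1 : Measurable fun (q : Fin L → (Fin m → X) × (Fin m → ℝ)) l => (q l).1 := by fun_prop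
      have h2 : Measurable fun (q : Fin L → (Fin m → X) × (Fin m → ℝ)) l => (q l).2 := by fun_prop
      exact (h1 hB).inter (h2 hC)
    have hjoint := measurable_lintegral_noRepeat hG'.measurable hB
    calc P.map (fun ω => (Y ω, Z ω)) (B ×ˢ C)
        = P {ω | G ω ∈ univ ∧ (fun l => (Y ω l, Z ω l)) ∈
            {q : Fin L → (Fin m → X) × (Fin m → ℝ) |
              (fun l => (q l).1) ∈ B ∧ (fun l => (q l).2) ∈ C}} := by
          rw [Measure.map_apply hmeas (hB.prod hC)]
          congr 1
          ext ω; simp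
      _ = ∫⁻ ω, (∫⁻ z in C ∩ N, ∫⁻ y : Fin L × Fin m → X, noRepeat B y * ENNReal.ofReal
            (Real.exp (-∫ x, availableTime precedes (Function.uncurry z) y x ∂G' ω))
              ∂(Measure.pi fun _ => G' ω)) ∂P := by
          rw [hYZ.condLaw univ _ .univ hset]
          simp only [mem_univ, ofPred_true, Measure.restrict_univ]
          refine lintegral_congr_ae (hae.mono fun ω hω => ?_)
          simp only
          rw [← hω]
          exact pi_rankingLaw_prod (G' ω) hB hC
      _ = ∫⁻ z in C ∩ N, (∫⁻ ω, (∫⁻ y : Fin L × Fin m → X, noRepeat B y * ENNReal.ofReal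
            (Real.exp (-∫ x, availableTime precedes (Function.uncurry z) y x ∂G' ω))
              ∂(Measure.pi fun _ => G' ω)) ∂P) :=
          lintegral_lintegral_swap hjoint.aemeasurable
      _ = ∫⁻ z in C ∩ N, (∫⁻ y in B, marginalDensity (levyIntensity α τ) h (y, z)
            ∂tiedMeasure L m μ) := by
          refine setLIntegral_congr_fun (hC.inter hNm) fun z hz => ?_
          rw [setLIntegral_marginalDensity hα hτ μ hh H hH hB hz.2]
          exact hG'.lintegral_availableTime hα hτ precedes (fun p => hz.2 p.1 p.2)
            (measurable_noRepeat hB) fun y => indicator_le_self' (fun _ _ => zero_le) y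
      _ = ∫⁻ z in C, (∫⁻ y in B, marginalDensity (levyIntensity α τ) h (y, z)
            ∂tiedMeasure L m μ) := by
          rw [inter_comm, ← Measure.restrict_restrict hNm, ← lintegral_indicator hNm]
          refine lintegral_congr fun z => ?_
          by_cases hz : z ∈ N
          · rw [indicator_of_mem hz]
          · rw [indicator_of_notMem hz]
            refine (lintegral_zero.symm.trans (lintegral_congr fun y => ?_))
            rw [marginalDensity, if_neg fun hc => hz hc.2]
      _ = _ := by
          rw [withDensity_apply _ (hB.prod hC), ← Measure.prod_restrict,
            lintegral_prod_symm _ hmd.aemeasurable]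
  -- Rectangles determine a measure once it is finite, and the law of the data is a probability;
  -- finiteness of the right side need not be shown separately.
  have : IsProbabilityMeasure (P.map fun ω => (Y ω, Z ω)) :=
    Measure.isProbabilityMeasure_map hmeas.aemeasurable
  refine ext_of_generate_finite _ generateFrom_prod.symm isPiSystem_prod ?_ ?_
  · rintro _ ⟨B, hB, C, hC, rfl⟩
    exact hrect B hB C hC
  · rw [← univ_prod_univ]
    exact hrect univ .univ univ .univ

theorem IsGammaProcess.integral_exp_neg_univ {Ω X : Type*} [MeasurableSpace Ω] [MeasurableSpace X]
    {P : Measure Ω} {α τ : ℝ} {H : Measure X} [IsProbabilityMeasure H] {G : Ω → Measure X}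
    (hG : IsGammaProcess α τ H G P) (hα : 0 < α) (hτ : 0 < τ) {z : ℝ} (hz : 0 ≤ z) :
    ∫ ω, Real.exp (-(z * (G ω univ).toReal)) ∂P = Real.exp (-gammaExponent α τ z) := by
  have hm : Measurable fun ω => Real.exp (-(z * (G ω univ).toReal)) :=
    ((hG.measurable_apply .univ).ennreal_toReal.const_mul z).neg.exp
  rw [integral_eq_lintegral_of_nonneg_ae (ae_of_all _ fun _ => (Real.exp_pos _).le)
    hm.aestronglyMeasurable, hG.lintegral_exp_neg hα hτ .univ (by linarith),
    ENNReal.toReal_ofReal (Real.exp_pos _).le]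
  simp

theorem theorem1 {Ω X : Type*} [MeasurableSpace Ω] [MeasurableSpace X] [MeasurableEq X]
    (P : Measure Ω) [IsProbabilityMeasure P]
    (α τ : ℝ) (hα : 0 < α) (hτ : 0 < τ)
    (μ : Measure X) [SigmaFinite μ] (h : X → ENNReal) (hh : Measurable h)
    (H : Measure X) [IsProbabilityMeasure H] [NullSingletonClass H] (hH : H = μ.withDensity h)
    (L m : ℕ) (G : Ω → Measure X) (hG : IsGammaProcess α τ H G P)
    (Y : Ω → Fin L → Fin m → X) (Z : Ω → Fin L → Fin m → ℝ)
    (hYZ : IsPlackettLuceSample G Y Z P) :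
    P.map (fun ω => (Y ω, Z ω)) =
        ((tiedMeasure L m μ).prod volume).withDensity
          (marginalDensity (levyIntensity α τ) h) ∧
      (∀ z : ℝ, 0 ≤ z →
        IntegrableOn (fun w => (1 - Real.exp (-(z * w))) * levyIntensity α τ w) (Ioi 0) ∧
        ∫ ω, Real.exp (-(z * (G ω univ).toReal)) ∂P =
          Real.exp (-laplaceExponent (levyIntensity α τ) z) ∧
        laplaceExponent (levyIntensity α τ) z =
          -Real.log (∫ ω, Real.exp (-(z * (G ω univ).toReal)) ∂P) ∧
        laplaceExponent (levyIntensity α τ) z = α * Real.log (1 + z / τ)) ∧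
      (∀ (n : ℕ) (z : ℝ), 1 ≤ n → 0 ≤ z →
        IntegrableOn (fun w => w ^ n * Real.exp (-(z * w)) * levyIntensity α τ w) (Ioi 0) ∧
        tiltedMoment (levyIntensity α τ) n z = α * Real.Gamma n / (z + τ) ^ n) := by
  refine ⟨map_eq_withDensity_marginalDensity P α τ hα hτ μ h hh H hH L m G hG Y Z hYZ,
    fun z hz => ⟨integrableOn_laplaceExponent hα hτ hz, ?_, ?_,
      laplaceExponent_levyIntensity hα hτ hz⟩,
    fun n z hn hz => ⟨integrableOn_tiltedMoment hα hτ hn hz,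
      tiltedMoment_levyIntensity hτ hn hz⟩⟩
  · rw [hG.integral_exp_neg_univ hα hτ hz, laplaceExponent_levyIntensity hα hτ hz]
  · rw [hG.integral_exp_neg_univ hα hτ hz, laplaceExponent_levyIntensity hα hτ hz,
      Real.log_exp, neg_neg]
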